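/- All varieties are complex tori $X=\mathbb C^k/\Lambda$ ($H_1(X,\mathbb Z)=\Lambda$), and morphisms are holomorphic group homomorphisms $f$, with induced map $f_*$ on $H_1$. A polarization $L_X$ is an integral alternating form on $H_1(X,\mathbb Z)$ which is the imaginary part of a positive definite Hermitian form. It has type $D=(d_1\mid\dots\mid d_n)$, with all $d_i>0$, if there is a symplectic basis of $H_1(X,\mathbb Z)$, i.e. one in which its matrix is $\widehat D=\begin{pmatrix}0&\mathrm{diag}(d_i)\\-\mathrm{diag}(d_i)&0\end{pmatrix}$. Isomorphisms of varieties with symplectic bases are required to preserve polarizations and bases. Let $\mathcal A'_D$ be the set of isomorphism classes of abelian varieties with a polarization of type $D$ and a symplectic basis. For types $D,H$ of the same dimension $n$ and an integer matrix $P$ of order $2n$, let $\mathcal{IS}'_{D,H}(P)$ be the set of isomorphism classes of isogenies $g:X\to Y$ between such varieties of types $D,H$, with $L_X=g^*L_Y$ and with $g_*$ represented by $P$ in the symplectic bases. Let $\delta=(D,D',E,H,H',K)$ be polarization types of dimensions $n,n',n+n',n,m',n+m'$, and let $\tau=(M,N,P)$ be integer matrices, where $M:\mathbb Z^{2n}\times\mathbb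 Z^{2n'}\to\mathbb Z^{2(n+n')}$, $N:\mathbb Z^{2n}\times\mathbb Z^{2m'}\to\mathbb Z^{2(n+m')}$ and $P:\mathbb Z^{2n}\to\mathbb Z^{2n}$. Consider commutative diagrams $$\begin{array}{ccc}X\times X'&\xrightarrow{\ s\ }&V\\ {\scriptstyle g\times 0}\downarrow&&\downarrow{\scriptstyle f}\\ Y\times Y'&\xrightarrow{\ t\ }&W\end{array}$$ in which $X,X',V,Y,Y',W$ are abelian varieties with polarizations of types $D,D',E,H,H',K$ and symplectic bases; $s$ and $t$ are isogenies which are sums of complementary embeddings (the restrictions of $s$ to $X$ and to $X'$ are injective and $s^*L_V=p^*L_X\otimes p'^*L_{X'}$, with $p,p'$ the projections, and likewise for $t$); and $g$ is an isogeny with $L_X=g^*L_Y$. This is the Poincaré decomposition of the morphism $f$. The morphism is of type $(\delta,\tau)$ if $s_*,t_*,g_*$ have matrices $M,N,P$ in the given bases. Let $\mathcal F'_\delta(\tau)$ be the set of isomorphism classes of such morphisms $f$ of type $(\delta,\tau)$ with symplectic bases, an isomorphism being given by isomorphisms of the six varieties which preserve polarizations and bases and commute with all the maps. The datum $(\delta,\tau)$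 is a type of morphisms if $\mathcal F'_\delta(\tau)\neq\emptyset$, or if it satisfies the following integral conditions: 1. $\widehat D\times\widehat D'={}^tM\widehat EM$, $\ \widehat H\times\widehat H'={}^tN\widehat KN$, $\ \widehat D={}^tP\widehat HP$; 2. there are integer matrices $R,R'$ (square of orders $2n,2n'$) and a commutative diagram with exact rows $$\begin{array}{ccccccccc}0&\to&\mathbb Z^{2n}\times\mathbb Z^{2n'}&\xrightarrow{R\times R'}&\mathbb Z^{2n}\times\mathbb Z^{2n'}&\to&F\times F&\to&0\\&&\|&&\uparrow&&\uparrow\\0&\to&\mathbb Z^{2n}\times\mathbb Z^{2n'}&\xrightarrow{\ M\ }&\mathbb Z^{2(n+n')}&\to&F&\to&0\end{array}$$ whose top row is the product of exact sequences $0\to\mathbb Z^{2n}\xrightarrow{R}\mathbb Z^{2n}\to F\to0$ and $0\to\mathbb Z^{2n'}\xrightarrow{R'}\mathbb Z^{2n'}\to F\to0$, and whose bottom row is its pullback under the diagonal $F\to F\times F$; moreover $P=\bar PR$ for some integer matrix $\bar P$; 3. there is a diagram as in 2 for $N$ (with some $R,R'$ of orders $2n,2m'$; no condition on $P$). **Proposition.**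 For every type of morphisms $(\delta,\tau)$, the natural map which to the class of $f$ associates the classes of the isogeny $g:X\to Y$ and of the varieties $X'$, $Y'$ of its decomposition (with their symplectic bases) is a bijection $$\mathcal F'_\delta(\tau)\ \longleftrightarrow\ \mathcal{IS}'_{D,H}(P)\times\mathcal A'_{D'}\times\mathcal A'_{H'}.$$ In other words, the morphism is determined by the isogeny $X\to Y$ of type $P$ together with the varieties $X'$ and $Y'$, and these can be given arbitrarily. -/

import Mathlib

open scoped Topology

universe u

namespace AbVar

/-! ### Complex tori and their morphisms -/

/-- A complex torus `V / Λ`: a finite dimensional complex vector space `V` with a lattice `Λ`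
(a discrete subgroup spanning `V` over the reals). Its first homology group `H_1(V / Λ, ℤ)` is `Λ`. -/
structure ComplexTorus : Type (u + 1) where
  V : Type u
  [normedAddCommGroup : NormedAddCommGroup V]
  [normedSpace : NormedSpace ℂ V]
  [finiteDimensional : FiniteDimensional ℂ V]
  Λ : Submodule ℤ V
  [discrete : DiscreteTopology Λ]
  span_eq_top : Submodule.span ℝ (Λ : Set V) = ⊤

namespace ComplexTorus

attribute [instance] normedAddCommGroup normedSpace finiteDimensional discrete

/-- The points of the torus. -/
abbrev Carrier (X : ComplexTorus.{u}) : Type u := X.V ⧸ X.Λ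

/-- The universal covering map `V → V / Λ`. -/
abbrev proj (X : ComplexTorus.{u}) : X.V →ₗ[ℤ] X.Carrier := X.Λ.mkQ

/-- A map of complex tori is holomorphic if locally it lifts to holomorphic maps between the
universal coverings (whose local inverses are the charts of the tori). -/
def IsHolomorphic {X Y : ComplexTorus.{u}} (f : X.Carrier → Y.Carrier) : Prop :=
  ∀ v : X.V, ∃ F : X.V → Y.V,
    (∀ᶠ z in 𝓝 v, DifferentiableAt ℂ F z) ∧ ∀ᶠ z in 𝓝 v, Y.proj (F z) = f (X.proj z)

/-- Morphisms of complex tori: holomorphic group homomorphisms. -/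
structure Hom (X Y : ComplexTorus.{u}) : Type u where
  toAddMonoidHom : X.Carrier →+ Y.Carrier
  holomorphic : IsHolomorphic (X := X) (Y := Y) toAddMonoidHom

instance (X Y : ComplexTorus.{u}) : CoeFun (Hom X Y) (fun _ => X.Carrier → Y.Carrier) :=
  ⟨fun f => f.toAddMonoidHom⟩

theorem proj_eq_zero {X : ComplexTorus.{u}} {v : X.V} : X.proj v = 0 ↔ v ∈ X.Λ := by
  simp [proj]

theorem exists_ball (X : ComplexTorus.{u}) :
    ∃ ε > 0, ∀ v ∈ X.Λ, ‖v‖ < ε → v = 0 := by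
  have h := (discreteTopology_subtype_iff'.1 X.discrete) 0 X.Λ.zero_mem
  obtain ⟨U, hU, hU'⟩ := h
  have h0 : (0 : X.V) ∈ U := by
    have : (0 : X.V) ∈ U ∩ (X.Λ : Set X.V) := by rw [hU']; rfl
    exact this.1
  obtain ⟨ε, hε, hb⟩ := Metric.isOpen_iff.1 hU 0 h0
  refine ⟨ε, hε, fun v hv hn => ?_⟩
  have : v ∈ U ∩ (X.Λ : Set X.V) := ⟨hb (by simpa using hn), hv⟩
  rw [hU'] at this
  exact this

theorem exists_small {V : Type u} [NormedAddCommGroup V] [NormedSpace ℂ V] (v : V) {r : ℝ}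
    (hr : 0 < r) : ∃ N : ℕ, 0 < N ∧ ‖((N : ℂ)⁻¹) • v‖ < r := by
  obtain ⟨N, hN⟩ := exists_nat_gt (‖v‖ / r)
  have hN0 : (0 : ℝ) < N := lt_of_le_of_lt (by positivity) hN
  refine ⟨N, by exact_mod_cast hN0, ?_⟩
  rw [norm_smul, norm_inv, Complex.norm_natCast, inv_mul_lt_iff₀ hN0]
  rwa [div_lt_iff₀ hr] at hN

/-- A morphism of complex tori lifts to a linear map of the universal coverings. -/
theorem Hom.exists_lift {X Y : ComplexTorus.{u}} (f : Hom X Y) :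
    ∃ ρ : X.V →ₗ[ℂ] Y.V, ∀ v, Y.proj (ρ v) = f (X.proj v) := by
  obtain ⟨F, hF, hFf⟩ := f.holomorphic 0
  have hc : F 0 ∈ Y.Λ := by
    have := hFf.self_of_nhds
    rw [map_zero, map_zero] at this
    exact proj_eq_zero.1 this
  have hd : DifferentiableAt ℂ F 0 := hF.self_of_nhds
  set A : X.V →L[ℂ] Y.V := fderiv ℂ F 0 with hA
  obtain ⟨ε, hε, hball⟩ := exists_ball Y
  set G : X.V → Y.V := fun v => F v - F 0 with hG
  have hGd : HasFDerivAt G A 0 := hd.hasFDerivAt.sub_const (F 0)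
  have hGlift : ∀ᶠ z in 𝓝 (0 : X.V), Y.proj (G z) = f (X.proj z) := by
    filter_upwards [hFf] with z hz
    rw [hG, map_sub, proj_eq_zero.2 hc, sub_zero, hz]
  have hGs : ∀ᶠ z in 𝓝 (0 : X.V), ‖G z‖ < ε / 3 := by
    have hcont : Filter.Tendsto (fun z => ‖G z‖) (𝓝 0) (𝓝 ‖G 0‖) :=
      hGd.continuousAt.norm
    have h0 : ‖G 0‖ = 0 := by simp [hG]
    rw [h0] at hcont
    exact hcont.eventually (gt_mem_nhds (by positivity))
  obtain ⟨r, hr, hrb⟩ := Metric.eventually_nhds_iff_ball.1 (hGlift.and hGs)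
  have hhalf : ∀ v : X.V, ‖v‖ < r → ‖(2 : ℂ)⁻¹ • v‖ < r := by
    intro v hv
    rw [norm_smul]
    have : ‖(2 : ℂ)⁻¹‖ = 1 / 2 := by simp
    rw [this]
    linarith [norm_nonneg v]
  have hdouble : ∀ v : X.V, ‖v‖ < r → G v = (2 : ℂ) • G ((2 : ℂ)⁻¹ • v) := by
    intro v hv
    obtain ⟨h1, h2⟩ := hrb v (by simpa using hv)
    obtain ⟨h3, h4⟩ := hrb ((2 : ℂ)⁻¹ • v) (by simpa using hhalf v hv)
    rw [← sub_eq_zero]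
    apply hball
    · rw [← proj_eq_zero, map_sub, h1, two_smul, map_add, h3, ← map_add, ← map_add, ← add_smul]
      norm_num
    · have h5 : ‖(2 : ℂ) • G ((2 : ℂ)⁻¹ • v)‖ = 2 * ‖G ((2 : ℂ)⁻¹ • v)‖ := by
        rw [norm_smul]; simp
      have := norm_sub_le (G v) ((2 : ℂ) • G ((2 : ℂ)⁻¹ • v))
      linarith
  have hpow : ∀ (k : ℕ) (v : X.V), ‖v‖ < r →
      G v = ((2 : ℂ) ^ k) • G (((2 : ℂ) ^ k)⁻¹ • v) := by
    intro k
    induction k with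
    | zero => intro v _; simp
    | succ k ih =>
      intro v hv
      rw [hdouble v hv, ih _ (hhalf v hv), smul_smul, smul_smul, pow_succ', mul_inv,
        mul_comm ((2 : ℂ) ^ k)⁻¹]
  have hGA : ∀ v : X.V, ‖v‖ < r → G v = A v := by
    intro v hv
    have hlim : Filter.Tendsto (fun k : ℕ => ((2 : ℂ) ^ k) • (G (0 + ((2 : ℂ) ^ k)⁻¹ • v) - G 0))
        Filter.atTop (𝓝 (A v)) := by
      apply hGd.lim v
      · have : (fun k : ℕ => ‖(2 : ℂ) ^ k‖) = fun k : ℕ => (2 : ℝ) ^ k := by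
          funext k; simp
        rw [this]
        exact tendsto_pow_atTop_atTop_of_one_lt (by norm_num)
    have hconst : (fun k : ℕ => ((2 : ℂ) ^ k) • (G (0 + ((2 : ℂ) ^ k)⁻¹ • v) - G 0))
        = fun _ => G v := by
      funext k
      rw [zero_add, hpow k v hv]
      simp [hG]
    rw [hconst] at hlim
    exact tendsto_nhds_unique tendsto_const_nhds hlim
  refine ⟨A, fun v => ?_⟩
  obtain ⟨N, hN0, hN⟩ := exists_small v hr
  have h1 := (hrb _ (by simpa using hN)).1
  rw [hGA _ hN] at h1
  have hv : v = N • ((N : ℂ)⁻¹ • v) := by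
    rw [← Nat.cast_smul_eq_nsmul ℂ, smul_smul, mul_inv_cancel₀ (by exact_mod_cast hN0.ne'), one_smul]
  rw [hv]
  simp only [ContinuousLinearMap.coe_coe, map_nsmul]
  rw [h1]

theorem lift_unique {X Y : ComplexTorus.{u}} {ρ σ : X.V →ₗ[ℂ] Y.V}
    (h : ∀ v, Y.proj (ρ v) = Y.proj (σ v)) : ρ = σ := by
  obtain ⟨ε, hε, hball⟩ := exists_ball Y
  ext v
  rw [← sub_eq_zero]
  obtain ⟨N, hN0, hN⟩ := exists_small (ρ v - σ v) hε
  have h1 : ((N : ℂ)⁻¹) • (ρ v - σ v) = 0 := by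
    apply hball _ _ hN
    rw [← proj_eq_zero, smul_sub, ← map_smul, ← map_smul, map_sub, h, sub_self]
  have hN' : ((N : ℂ)⁻¹) ≠ 0 := inv_ne_zero (by exact_mod_cast hN0.ne')
  exact (smul_eq_zero.1 h1).resolve_left hN'

/-- The analytic representation: the linear lift of a morphism of complex tori. -/
noncomputable def Hom.lift {X Y : ComplexTorus.{u}} (f : Hom X Y) : X.V →ₗ[ℂ] Y.V :=
  f.exists_lift.choose

theorem Hom.proj_lift {X Y : ComplexTorus.{u}} (f : Hom X Y) (v : X.V) :
    Y.proj (f.lift v) = f (X.proj v) :=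
  f.exists_lift.choose_spec v

theorem Hom.lift_mem {X Y : ComplexTorus.{u}} (f : Hom X Y) {v : X.V} (hv : v ∈ X.Λ) :
    f.lift v ∈ Y.Λ := by
  rw [← proj_eq_zero, f.proj_lift, proj_eq_zero.2 hv, map_zero]

/-- The rational representation `f_* : H_1(X, ℤ) → H_1(Y, ℤ)` of a morphism. -/
noncomputable def Hom.homology {X Y : ComplexTorus.{u}} (f : Hom X Y) : X.Λ →ₗ[ℤ] Y.Λ :=
  (f.lift.restrictScalars ℤ).restrict fun _ hv => f.lift_mem hv

@[simp] theorem Hom.coe_homology {X Y : ComplexTorus.{u}} (f : Hom X Y) (x : X.Λ) :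
    (f.homology x : Y.V) = f.lift x := rfl

/-- The identity morphism. -/
def Hom.id (X : ComplexTorus.{u}) : Hom X X where
  toAddMonoidHom := AddMonoidHom.id _
  holomorphic := fun _ => ⟨fun v => v, Filter.Eventually.of_forall fun _ => differentiableAt_id,
    Filter.Eventually.of_forall fun _ => rfl⟩

/-- The composition of morphisms. -/
def Hom.comp {X Y Z : ComplexTorus.{u}} (g : Hom Y Z) (f : Hom X Y) : Hom X Z where
  toAddMonoidHom := g.toAddMonoidHom.comp f.toAddMonoidHom
  holomorphic := fun _ => ⟨fun v => g.lift (f.lift v),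
    Filter.Eventually.of_forall fun _ =>
      (g.lift ∘ₗ f.lift).toContinuousLinearMap.differentiableAt,
    Filter.Eventually.of_forall fun z => by
      rw [g.proj_lift, f.proj_lift]; rfl⟩

theorem Hom.homology_eq {X Y : ComplexTorus.{u}} (f : Hom X Y) (ρ : X.V →ₗ[ℂ] Y.V)
    (h : ∀ v, Y.proj (ρ v) = f (X.proj v)) (x : X.Λ) : (f.homology x : Y.V) = ρ x := by
  have : f.lift = ρ := lift_unique fun v => by rw [f.proj_lift, h]
  rw [f.coe_homology, this]

theorem Hom.homology_of_eq_id {X : ComplexTorus.{u}} (f : Hom X X) (h : ∀ x, f x = x) (x : X.Λ) :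
    f.homology x = x :=
  Subtype.ext (f.homology_eq LinearMap.id (fun v => by rw [h]; rfl) x)

theorem Hom.homology_comp {X Y Z : ComplexTorus.{u}} (g : Hom Y Z) (f : Hom X Y) (x : X.Λ) :
    (g.comp f).homology x = g.homology (f.homology x) :=
  Subtype.ext ((g.comp f).homology_eq (g.lift ∘ₗ f.lift)
    (fun v => by rw [LinearMap.comp_apply, g.proj_lift, f.proj_lift]; rfl) x)

theorem Hom.ext_fun {X Y : ComplexTorus.{u}} {f g : Hom X Y} (h : ∀ x, f x = g x) : f = g := by
  obtain ⟨f, hf⟩ := f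
  obtain ⟨g, hg⟩ := g
  have : f = g := AddMonoidHom.ext h
  subst this
  rfl

/-- Isomorphisms of complex tori. -/
def Hom.IsIso {X Y : ComplexTorus.{u}} (f : Hom X Y) : Prop :=
  ∃ g : Hom Y X, (∀ x, g (f x) = x) ∧ ∀ y, f (g y) = y

/-- A polarization of the torus `X = V / Λ`, identified with its alternating form on
`H_1(X, ℤ) = Λ`: an integral form which is the imaginary part of a positive definite Hermitian
form on `V`. -/
def IsPolarization (X : ComplexTorus.{u}) (L : X.Λ →ₗ[ℤ] X.Λ →ₗ[ℤ] ℤ) : Prop :=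
  ∃ h : X.V →ₗ[ℂ] X.V →ₗ⋆[ℂ] ℂ,
    (∀ x y, h y x = (starRingEnd ℂ) (h x y)) ∧
    (∀ x, x ≠ 0 → 0 < (h x x).re) ∧
    ∀ x y : X.Λ, (L x y : ℝ) = (h x y).im

end ComplexTorus

open ComplexTorus

/-- Isogenies: surjective homomorphisms with finite kernel. -/
def IsIsogeny {A B : Type u} [AddCommGroup A] [AddCommGroup B] (f : A →+ B) : Prop :=
  Function.Surjective f ∧ Finite f.ker

/-! ### Polarized abelian varieties with symplectic bases -/

/-- A polarization type of dimension `n`: positive integers `d_1 ∣ d_2 ∣ ⋯ ∣ d_n`. -/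
structure PolType (n : ℕ) where
  d : Fin n → ℕ
  pos : ∀ i, 0 < d i
  dvd : ∀ i j, i ≤ j → d i ∣ d j

/-- The index set of a symplectic basis `λ_1, …, λ_n, λ_{n+1}, …, λ_{2n}`. -/
abbrev SpIdx (n : ℕ) : Type := Fin n ⊕ Fin n

/-- The matrix of the alternating form of the given type with respect to a symplectic basis. -/
def PolType.hat {n : ℕ} (D : PolType n) : Matrix (SpIdx n) (SpIdx n) ℤ :=
  Matrix.fromBlocks 0 (Matrix.diagonal fun i => (D.d i : ℤ))
    (-(Matrix.diagonal fun i => (D.d i : ℤ))) 0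

/-- An abelian variety with a polarization of type `D` and a symplectic basis for it. -/
structure MarkedAV {n : ℕ} (D : PolType n) : Type (u + 1) where
  torus : ComplexTorus.{u}
  form : torus.Λ →ₗ[ℤ] torus.Λ →ₗ[ℤ] ℤ
  polarization : torus.IsPolarization form
  basis : Module.Basis (SpIdx n) ℤ torus.Λ
  symplectic : ∀ i j, form (basis i) (basis j) = D.hat i j

/-- Isomorphisms which preserve the polarizations and the symplectic bases. -/
structure IsMarkedIso {n : ℕ} {D : PolType n} (X Y : MarkedAV.{u} D)
    (a : Hom X.torus Y.torus) : Prop where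
  isIso : a.IsIso
  form_eq : ∀ x y, Y.form (a.homology x) (a.homology y) = X.form x y
  basis_eq : ∀ i, a.homology (X.basis i) = Y.basis i

theorem IsMarkedIso.refl {n : ℕ} {D : PolType n} (X : MarkedAV.{u} D) :
    IsMarkedIso X X (Hom.id X.torus) := by
  have h := (Hom.id X.torus).homology_of_eq_id (fun _ => rfl)
  exact ⟨⟨Hom.id X.torus, fun _ => rfl, fun _ => rfl⟩, fun x y => by rw [h, h],
    fun i => h _⟩

theorem IsMarkedIso.comp {n : ℕ} {D : PolType n} {X Y Z : MarkedAV.{u} D}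
    {b : Hom Y.torus Z.torus} {a : Hom X.torus Y.torus}
    (hb : IsMarkedIso Y Z b) (ha : IsMarkedIso X Y a) : IsMarkedIso X Z (b.comp a) := by
  obtain ⟨a', h1, h2⟩ := ha.isIso
  obtain ⟨b', h3, h4⟩ := hb.isIso
  refine ⟨⟨a'.comp b', fun x => ?_, fun y => ?_⟩, fun x y => ?_, fun i => ?_⟩
  · change a' (b' (b (a x))) = x
    rw [h3, h1]
  · change b (a (a' (b' y))) = y
    rw [h2, h4]
  · rw [Hom.homology_comp, Hom.homology_comp, hb.form_eq, ha.form_eq]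
  · rw [Hom.homology_comp, ha.basis_eq, hb.basis_eq]

theorem IsMarkedIso.exists_inv {n : ℕ} {D : PolType n} {X Y : MarkedAV.{u} D}
    {a : Hom X.torus Y.torus} (ha : IsMarkedIso X Y a) :
    ∃ b : Hom Y.torus X.torus, IsMarkedIso Y X b ∧ (∀ x, b (a x) = x) ∧ ∀ y, a (b y) = y := by
  obtain ⟨b, h1, h2⟩ := ha.isIso
  have h3 : ∀ x, b.homology (a.homology x) = x := fun x => by
    rw [← Hom.homology_comp]
    exact Hom.homology_of_eq_id _ h1 x
  have h4 : ∀ y, a.homology (b.homology y) = y := fun y => by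
    rw [← Hom.homology_comp]
    exact Hom.homology_of_eq_id _ h2 y
  refine ⟨b, ⟨⟨a, h2, h1⟩, fun x y => ?_, fun i => ?_⟩, h1, h2⟩
  · rw [← ha.form_eq, h4, h4]
  · rw [← ha.basis_eq, h3]

instance MarkedAV.setoid {n : ℕ} (D : PolType n) : Setoid (MarkedAV.{u} D) where
  r X Y := ∃ a : Hom X.torus Y.torus, IsMarkedIso X Y a
  iseqv :=
    { refl := fun X => ⟨_, IsMarkedIso.refl X⟩
      symm := fun ⟨_, ha⟩ => let ⟨b, hb, _⟩ := ha.exists_inv; ⟨b, hb⟩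
      trans := fun ⟨_, ha⟩ ⟨_, hb⟩ => ⟨_, hb.comp ha⟩ }

/-- The set `A'_D` of isomorphism classes of abelian varieties with a polarization of type `D` and
a symplectic basis. -/
def ModuliAV {n : ℕ} (D : PolType n) : Type (u + 1) := Quotient (MarkedAV.setoid.{u} D)

/-- The matrix of `f_*` with respect to the symplectic bases. -/
noncomputable def homMatrix {n m : ℕ} {D : PolType n} {E : PolType m} (X : MarkedAV.{u} D)
    (Y : MarkedAV.{u} E) (f : Hom X.torus Y.torus) : Matrix (SpIdx m) (SpIdx n) ℤ :=
  LinearMap.toMatrix X.basis Y.basis f.homology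

theorem homMatrix_congr {n m : ℕ} {D : PolType n} {E : PolType m} {X X₁ : MarkedAV.{u} D}
    {Y Y₁ : MarkedAV.{u} E} {f : Hom X.torus Y.torus} {f₁ : Hom X₁.torus Y₁.torus}
    {a : Hom X.torus X₁.torus} {b : Hom Y.torus Y₁.torus}
    (ha : IsMarkedIso X X₁ a) (hb : IsMarkedIso Y Y₁ b) (h : ∀ x, b (f x) = f₁ (a x)) :
    homMatrix X Y f = homMatrix X₁ Y₁ f₁ := by
  have hcomp : b.comp f = f₁.comp a := Hom.ext_fun h
  have hY : ∀ y, Y₁.basis.repr (b.homology y) = Y.basis.repr y := by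
    have : Y₁.basis.repr.toLinearMap ∘ₗ b.homology = Y.basis.repr.toLinearMap :=
      Y.basis.ext fun i => by simp [hb.basis_eq]
    exact fun y => LinearMap.congr_fun this y
  ext i j
  rw [homMatrix, homMatrix, LinearMap.toMatrix_apply, LinearMap.toMatrix_apply, ← ha.basis_eq,
    ← Hom.homology_comp, ← hcomp, Hom.homology_comp, hY]

/-! ### Isogenies of polarized abelian varieties -/

/-- An isogeny `g : X → Y` of polarized abelian varieties (`L_X = g^* L_Y`) of types `D`, `H`, with
symplectic bases. -/
structure MarkedIsogeny {n : ℕ} (D H : PolType n) : Type (u + 1) where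
  X : MarkedAV.{u} D
  Y : MarkedAV.{u} H
  g : Hom X.torus Y.torus
  isogeny : IsIsogeny g.toAddMonoidHom
  pullback : ∀ x y, Y.form (g.homology x) (g.homology y) = X.form x y

/-- Isogenies are isomorphic if there are isomorphisms of the sources and of the targets which
preserve polarizations and bases and commute with the isogenies. -/
instance MarkedIsogeny.setoid {n : ℕ} (D H : PolType n) : Setoid (MarkedIsogeny.{u} D H) where
  r S T := ∃ (a : Hom S.X.torus T.X.torus) (b : Hom S.Y.torus T.Y.torus),
    IsMarkedIso S.X T.X a ∧ IsMarkedIso S.Y T.Y b ∧ ∀ x, b (S.g x) = T.g (a x)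
  iseqv :=
    { refl := fun S => ⟨_, _, IsMarkedIso.refl S.X, IsMarkedIso.refl S.Y, fun _ => rfl⟩
      symm := by
        rintro S T ⟨a, b, ha, hb, h⟩
        obtain ⟨a', ha', _, h2⟩ := ha.exists_inv
        obtain ⟨b', hb', h3, _⟩ := hb.exists_inv
        refine ⟨a', b', ha', hb', fun x => ?_⟩
        rw [← h3 (S.g (a' x)), h, h2]
      trans := by
        rintro S T U ⟨a, b, ha, hb, h⟩ ⟨c, d, hc, hd, h'⟩
        refine ⟨c.comp a, d.comp b, hc.comp ha, hd.comp hb, fun x => ?_⟩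
        change d (b (S.g x)) = U.g (c (a x))
        rw [h, h'] }

/-- The set `IS'_{D,H}` of isomorphism classes of isogenies with symplectic bases. -/
def ModuliIsogeny {n : ℕ} (D H : PolType n) : Type (u + 1) :=
  Quotient (MarkedIsogeny.setoid.{u} D H)

/-- The matrix of an isomorphism class of isogenies with symplectic bases. -/
noncomputable def ModuliIsogeny.matrix {n : ℕ} {D H : PolType n} :
    ModuliIsogeny.{u} D H → Matrix (SpIdx n) (SpIdx n) ℤ :=
  Quotient.lift (fun S => homMatrix S.X S.Y S.g)
    fun _ _ ⟨_, _, ha, hb, h⟩ => homMatrix_congr ha hb h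

/-- The fibre `IS'_{D,H}(P)` over the matrix `P`. -/
def isogenyFibre {n : ℕ} (D H : PolType n) (P : Matrix (SpIdx n) (SpIdx n) ℤ) :
    Set (ModuliIsogeny.{u} D H) :=
  {c | c.matrix = P}

/-! ### Morphisms with their Poincaré decomposition -/

/-- The sum `X × X' → V`, `(x, x') ↦ e x + e' x'` of two homomorphisms. -/
abbrev sumHom {X X' V : ComplexTorus.{u}} (e : Hom X V) (e' : Hom X' V) :
    X.Carrier × X'.Carrier →+ V.Carrier :=
  AddMonoidHom.coprod e.toAddMonoidHom e'.toAddMonoidHom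

/-- The sum `s : X × X' → V` of `e` and `e'` is an isogeny which is a sum of complementary
embeddings: `e` and `e'` are embeddings, and the polarizations satisfy
`s^* L_V = p^* L_X ⊗ p'^* L_{X'}`. -/
structure IsComplementarySum {n n' k : ℕ} {D : PolType n} {D' : PolType n'} {E : PolType k}
    (X : MarkedAV.{u} D) (X' : MarkedAV.{u} D') (V : MarkedAV.{u} E)
    (e : Hom X.torus V.torus) (e' : Hom X'.torus V.torus) : Prop where
  injective : Function.Injective e
  injective' : Function.Injective e'
  isogeny : IsIsogeny (sumHom e e')
  form_eq : ∀ x y x' y',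
    V.form (e.homology x + e'.homology x') (e.homology y + e'.homology y') =
      X.form x y + X'.form x' y'

/-- The matrix of `s_* : H_1(X) × H_1(X') → H_1(V)`, for the sum `s` of `e` and `e'`. -/
noncomputable def sumMatrix {n n' k : ℕ} {D : PolType n} {D' : PolType n'} {E : PolType k}
    (X : MarkedAV.{u} D) (X' : MarkedAV.{u} D') (V : MarkedAV.{u} E)
    (e : Hom X.torus V.torus) (e' : Hom X'.torus V.torus) :
    Matrix (SpIdx k) (SpIdx n ⊕ SpIdx n') ℤ :=
  Matrix.fromCols (homMatrix X V e) (homMatrix X' V e')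

/-- A polarization type `δ = (D, D', E, H, H', K)` of morphisms. -/
structure MorPolType (n n' m' : ℕ) where
  D : PolType n
  D' : PolType n'
  E : PolType (n + n')
  H : PolType n
  H' : PolType m'
  K : PolType (n + m')

/-- A sequence `τ = (M, N, P)` of integer matrices. -/
structure MorMatrices (n n' m' : ℕ) where
  M : Matrix (SpIdx (n + n')) (SpIdx n ⊕ SpIdx n') ℤ
  N : Matrix (SpIdx (n + m')) (SpIdx n ⊕ SpIdx m') ℤ
  P : Matrix (SpIdx n) (SpIdx n) ℤ

/-- A morphism `f : V → W` compatible with the polarizations, with its Poincaré decomposition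
```
  X × X'  --s-->  V
   | g × 0        | f
  Y × Y'  --t-->  W
```
of polarization type `δ`, all varieties being endowed with symplectic bases. Here `s` is the sum of
`e, e'`, and `t` is the sum of `ε, ε'`. -/
structure MarkedMorphism {n n' m' : ℕ} (δ : MorPolType n n' m') : Type (u + 1) where
  X : MarkedAV.{u} δ.D
  X' : MarkedAV.{u} δ.D'
  V : MarkedAV.{u} δ.E
  Y : MarkedAV.{u} δ.H
  Y' : MarkedAV.{u} δ.H'
  W : MarkedAV.{u} δ.K
  f : Hom V.torus W.torus
  e : Hom X.torus V.torus
  e' : Hom X'.torus V.torus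
  ε : Hom Y.torus W.torus
  ε' : Hom Y'.torus W.torus
  g : Hom X.torus Y.torus
  source_sum : IsComplementarySum X X' V e e'
  target_sum : IsComplementarySum Y Y' W ε ε'
  isogeny : IsIsogeny g.toAddMonoidHom
  pullback : ∀ x y, Y.form (g.homology x) (g.homology y) = X.form x y
  comm : ∀ x x', f (sumHom e e' (x, x')) = sumHom ε ε' (g x, 0)

/-- Isomorphisms of morphisms with decomposition: isomorphisms of the six varieties which preserve
polarizations and bases and commute with all the maps of the decomposition. -/
structure MarkedMorphism.Iso {n n' m' : ℕ} {δ : MorPolType n n' m'}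
    (S T : MarkedMorphism.{u} δ) where
  aX : Hom S.X.torus T.X.torus
  aX' : Hom S.X'.torus T.X'.torus
  aV : Hom S.V.torus T.V.torus
  aY : Hom S.Y.torus T.Y.torus
  aY' : Hom S.Y'.torus T.Y'.torus
  aW : Hom S.W.torus T.W.torus
  isoX : IsMarkedIso S.X T.X aX
  isoX' : IsMarkedIso S.X' T.X' aX'
  isoV : IsMarkedIso S.V T.V aV
  isoY : IsMarkedIso S.Y T.Y aY
  isoY' : IsMarkedIso S.Y' T.Y' aY'
  isoW : IsMarkedIso S.W T.W aW
  comm_e : ∀ x, aV (S.e x) = T.e (aX x)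
  comm_e' : ∀ x, aV (S.e' x) = T.e' (aX' x)
  comm_ε : ∀ x, aW (S.ε x) = T.ε (aY x)
  comm_ε' : ∀ x, aW (S.ε' x) = T.ε' (aY' x)
  comm_g : ∀ x, aY (S.g x) = T.g (aX x)
  comm_f : ∀ x, aW (S.f x) = T.f (aV x)

theorem comm_inv {X X₁ Y Y₁ : ComplexTorus.{u}} {f : Hom X Y} {f₁ : Hom X₁ Y₁}
    {a : Hom X X₁} {b : Hom Y Y₁} {a' : Hom X₁ X} {b' : Hom Y₁ Y}
    (h : ∀ x, b (f x) = f₁ (a x)) (ha : ∀ x, a (a' x) = x) (hb : ∀ y, b' (b y) = y) (x : X₁.Carrier) :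
    b' (f₁ x) = f (a' x) := by
  rw [← hb (f (a' x)), h, ha]

theorem comm_trans {X X₁ X₂ Y Y₁ Y₂ : ComplexTorus.{u}} {f : Hom X Y} {f₁ : Hom X₁ Y₁}
    {f₂ : Hom X₂ Y₂} {a : Hom X X₁} {b : Hom Y Y₁} {c : Hom X₁ X₂} {d : Hom Y₁ Y₂}
    (h : ∀ x, b (f x) = f₁ (a x)) (h' : ∀ x, d (f₁ x) = f₂ (c x)) (x : X.Carrier) :
    (d.comp b) (f x) = f₂ ((c.comp a) x) := by
  change d (b (f x)) = f₂ (c (a x))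
  rw [h, h']

instance MarkedMorphism.setoid {n n' m' : ℕ} (δ : MorPolType n n' m') :
    Setoid (MarkedMorphism.{u} δ) where
  r S T := Nonempty (MarkedMorphism.Iso S T)
  iseqv :=
    { refl := fun S => ⟨⟨_, _, _, _, _, _, .refl S.X, .refl S.X', .refl S.V, .refl S.Y,
        .refl S.Y', .refl S.W, fun _ => rfl, fun _ => rfl, fun _ => rfl, fun _ => rfl,
        fun _ => rfl, fun _ => rfl⟩⟩
      symm := by
        rintro S T ⟨i⟩
        obtain ⟨bX, hX, hX1, hX2⟩ := i.isoX.exists_inv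
        obtain ⟨bX', hX', hX1', hX2'⟩ := i.isoX'.exists_inv
        obtain ⟨bV, hV, hV1, hV2⟩ := i.isoV.exists_inv
        obtain ⟨bY, hY, hY1, hY2⟩ := i.isoY.exists_inv
        obtain ⟨bY', hY', hY1', hY2'⟩ := i.isoY'.exists_inv
        obtain ⟨bW, hW, hW1, hW2⟩ := i.isoW.exists_inv
        exact ⟨⟨bX, bX', bV, bY, bY', bW, hX, hX', hV, hY, hY', hW,
          comm_inv i.comm_e hX2 hV1, comm_inv i.comm_e' hX2' hV1, comm_inv i.comm_ε hY2 hW1,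
          comm_inv i.comm_ε' hY2' hW1, comm_inv i.comm_g hX2 hY1, comm_inv i.comm_f hV2 hW1⟩⟩
      trans := by
        rintro S T U ⟨i⟩ ⟨j⟩
        exact ⟨⟨_, _, _, _, _, _, j.isoX.comp i.isoX, j.isoX'.comp i.isoX', j.isoV.comp i.isoV,
          j.isoY.comp i.isoY, j.isoY'.comp i.isoY', j.isoW.comp i.isoW,
          comm_trans i.comm_e j.comm_e, comm_trans i.comm_e' j.comm_e',
          comm_trans i.comm_ε j.comm_ε, comm_trans i.comm_ε' j.comm_ε',
          comm_trans i.comm_g j.comm_g, comm_trans i.comm_f j.comm_f⟩⟩ }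

/-- The set of isomorphism classes of morphisms of polarization type `δ` with symplectic bases. -/
def ModuliMorphism {n n' m' : ℕ} (δ : MorPolType n n' m') : Type (u + 1) :=
  Quotient (MarkedMorphism.setoid.{u} δ)

/-- The matrices `τ = (M, N, P)` of the decomposition with respect to the symplectic bases. -/
noncomputable def ModuliMorphism.matrices {n n' m' : ℕ} {δ : MorPolType n n' m'} :
    ModuliMorphism.{u} δ → MorMatrices n n' m' :=
  Quotient.lift
    (fun S => ⟨sumMatrix S.X S.X' S.V S.e S.e', sumMatrix S.Y S.Y' S.W S.ε S.ε',
      homMatrix S.X S.Y S.g⟩)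
    (by
      rintro S T ⟨i⟩
      simp only [sumMatrix]
      rw [homMatrix_congr i.isoX i.isoV i.comm_e, homMatrix_congr i.isoX' i.isoV i.comm_e',
        homMatrix_congr i.isoY i.isoW i.comm_ε, homMatrix_congr i.isoY' i.isoW i.comm_ε',
        homMatrix_congr i.isoX i.isoY i.comm_g])

/-- The fibre over `τ`: isomorphism classes of morphisms of type `δ, τ` relative to the bases. -/
def morphismFibre {n n' m' : ℕ} (δ : MorPolType n n' m') (τ : MorMatrices n n' m') :
    Set (ModuliMorphism.{u} δ) :=
  {c | c.matrices = τ}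

/-- The isogeny `g : X → Y` of the decomposition of a morphism. -/
def MarkedMorphism.toIsogeny {n n' m' : ℕ} {δ : MorPolType n n' m'} (S : MarkedMorphism.{u} δ) :
    MarkedIsogeny.{u} δ.D δ.H :=
  ⟨S.X, S.Y, S.g, S.isogeny, S.pullback⟩

/-- The natural map, which to the class of a morphism associates the classes of the isogeny
`g : X → Y` and of the varieties `X'`, `Y'` of its decomposition. -/
def ModuliMorphism.toTriple {n n' m' : ℕ} {δ : MorPolType n n' m'} :
    ModuliMorphism.{u} δ → ModuliIsogeny.{u} δ.D δ.H × ModuliAV.{u} δ.D' × ModuliAV.{u} δ.H' :=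
  Quotient.lift
    (fun S => (Quotient.mk (MarkedIsogeny.setoid δ.D δ.H) S.toIsogeny,
      Quotient.mk (MarkedAV.setoid δ.D') S.X', Quotient.mk (MarkedAV.setoid δ.H') S.Y'))
    (by
      rintro S T ⟨i⟩
      exact Prod.ext (Quotient.sound ⟨i.aX, i.aY, i.isoX, i.isoY, i.comm_g⟩)
        (Prod.ext (Quotient.sound ⟨i.aX', i.isoX'⟩) (Quotient.sound ⟨i.aY', i.isoY'⟩)))

/-! ### Types of morphisms -/

/-- The matrices `M`, `R`, `R'` fit into a commutative diagram with exact rows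
```
  0 → ℤ^{2n} × ℤ^{2n'} --R × R'--> ℤ^{2n} × ℤ^{2n'} --q × q'--> F × F → 0
            ||                          ↑ S                      ↑ diagonal
  0 → ℤ^{2n} × ℤ^{2n'} -----M---->   ℤ^{2(n+n')}   -----p----->  F   → 0
```
whose bottom row is the pullback of the top row under the diagonal of `F`. -/
def EmbeddingDiagram {n n' : ℕ} (M : Matrix (SpIdx (n + n')) (SpIdx n ⊕ SpIdx n') ℤ)
    (R : Matrix (SpIdx n) (SpIdx n) ℤ) (R' : Matrix (SpIdx n') (SpIdx n') ℤ) : Prop :=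
  ∃ (F : Type) (_ : AddCommGroup F) (p : (SpIdx (n + n') → ℤ) →+ F)
    (q : (SpIdx n → ℤ) →+ F) (q' : (SpIdx n' → ℤ) →+ F)
    (S : Matrix (SpIdx n ⊕ SpIdx n') (SpIdx (n + n')) ℤ),
    (Function.Injective M.mulVec ∧ Function.Exact M.mulVec p ∧ Function.Surjective p) ∧
    (Function.Injective R.mulVec ∧ Function.Exact R.mulVec q ∧ Function.Surjective q) ∧
    (Function.Injective R'.mulVec ∧ Function.Exact R'.mulVec q' ∧ Function.Surjective q') ∧
    S * M = Matrix.fromBlocks R 0 0 R' ∧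
    (∀ z, q (fun i => S.mulVec z (Sum.inl i)) = p z ∧ q' (fun i => S.mulVec z (Sum.inr i)) = p z) ∧
    ∀ (c : F) (a : SpIdx n → ℤ) (a' : SpIdx n' → ℤ), q a = c → q' a' = c →
      ∃! z, p z = c ∧ S.mulVec z = Sum.elim a a'

/-- The integral conditions on `δ, τ`: the equalities relating the polarization types to the
matrices, the condition that `M` and `N` represent sums of embeddings, and the factorization
`P = P̄ R` through the matrix `R` with cokernel `F` (it makes `N (P × 0) M⁻¹` integral). -/
structure TypeConditions {n n' m' : ℕ} (δ : MorPolType n n' m') (τ : MorMatrices n n' m') :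
    Prop where
  source_form : Matrix.fromBlocks δ.D.hat 0 0 δ.D'.hat = τ.M.transpose * δ.E.hat * τ.M
  target_form : Matrix.fromBlocks δ.H.hat 0 0 δ.H'.hat = τ.N.transpose * δ.K.hat * τ.N
  isogeny_form : δ.D.hat = τ.P.transpose * δ.H.hat * τ.P
  source_diagram : ∃ R R', EmbeddingDiagram τ.M R R' ∧ ∃ Pbar, τ.P = Pbar * R
  target_diagram : ∃ R R', EmbeddingDiagram τ.N R R'

end AbVar

/-!
Everything is expressed through matrices. The symplectic basis of `H_1(X, ℤ) = Λ` is a real basis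
of the universal covering, so a morphism is determined by its integer matrix (`hom_ext_matrix`), and
an integer matrix represents a morphism exactly when the real linear map it defines is complex
linear. An isomorphism preserves polarizations and symplectic bases exactly when its matrix is the
identity (`isMarkedIso_iff`).

A pair of homomorphisms `e, e'` from `X, X'` to `V` is a sum of complementary embeddings if and only
if its matrix `M` satisfies numerical conditions (`isComplementarySum_iff`): `ᵗM Ê M` is the matrix
of the product polarization, and the two blocks of columns of `M` are primitive. The first condition
makes `M` invertible over `ℚ`, so the lifts of `e` and `e'` span the universal covering of `V`;
hence an integer matrix on `H_1(V)` represents a morphism as soon as its composites with `e` and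
`e'` do (`exists_hom_of_sum`).

A type of morphisms, for either of the two reasons allowed, satisfies these conditions for `M` and
`N`, and `G = N (P × 0) M⁻¹` is an integer matrix (`IsMorphismType`).

* Injectivity (`MarkedMorphism.nonempty_iso`): given isomorphisms of the isogenies `X → Y` and of
  the complements, the identity matrix on `H_1(V)` and on `H_1(W)` represents isomorphisms. They
  commute with `f`, whose matrix is necessarily `G`.
* Surjectivity (`exists_markedMorphism`): given `X → Y`, `X'` and `Y'`, the variety `V` is the vector
  space of `X × X'` modulo the overlattice of `H_1(X) × H_1(X')` with the basis of which `M` is the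
  matrix (`exists_complementarySum`), and `W` is obtained from `Y`, `Y'` and `N` in the same way. The
  matrix `G` then represents a morphism `f`, since its composites with the two summands of `V` are
  `Y → W` after `X → Y`, and zero.
-/

namespace AbVar

open ComplexTorus Matrix

/-! ### Real coordinates on the universal covering -/

/-- A symplectic basis of `H_1(X, ℤ) = Λ`, viewed as a real basis of the universal covering. -/
noncomputable def MarkedAV.realBasis {n : ℕ} {D : PolType n} (X : MarkedAV.{u} D) :
    Module.Basis (SpIdx n) ℝ X.torus.V :=
  haveI : IsZLattice ℝ X.torus.Λ := ⟨X.torus.span_eq_top⟩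
  X.basis.ofZLatticeBasis ℝ X.torus.Λ

@[simp] theorem MarkedAV.realBasis_apply {n : ℕ} {D : PolType n} (X : MarkedAV.{u} D)
    (i : SpIdx n) : X.realBasis i = X.basis i := by
  have : IsZLattice ℝ X.torus.Λ := ⟨X.torus.span_eq_top⟩
  exact X.basis.ofZLatticeBasis_apply ℝ X.torus.Λ i

theorem MarkedAV.realBasis_repr {n : ℕ} {D : PolType n} (X : MarkedAV.{u} D)
    (x : X.torus.Λ) (i : SpIdx n) : X.realBasis.repr (x : X.torus.V) i = X.basis.repr x i := by
  have : IsZLattice ℝ X.torus.Λ := ⟨X.torus.span_eq_top⟩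
  exact X.basis.ofZLatticeBasis_repr_apply ℝ X.torus.Λ x i

theorem MarkedAV.mem_lattice_iff {n : ℕ} {D : PolType n} (X : MarkedAV.{u} D) (v : X.torus.V) :
    v ∈ X.torus.Λ ↔ ∃ c : SpIdx n → ℤ, ⇑(X.realBasis.repr v) = fun i => (c i : ℝ) := by
  constructor
  · intro hv
    exact ⟨X.basis.repr ⟨v, hv⟩, funext fun i => X.realBasis_repr ⟨v, hv⟩ i⟩
  · rintro ⟨c, hc⟩
    rw [← X.realBasis.sum_repr v, hc]
    refine Submodule.sum_mem _ fun i _ => ?_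
    rw [X.realBasis_apply, Int.cast_smul_eq_zsmul]
    exact Submodule.smul_mem _ _ (X.basis i).2

/-- An integer matrix, viewed as a real matrix. -/
noncomputable abbrev realMatrix {ι κ : Type*} (A : Matrix ι κ ℤ) : Matrix ι κ ℝ :=
  A.map (Int.castRingHom ℝ)

theorem realMatrix_injective {ι κ : Type*} :
    Function.Injective (realMatrix : Matrix ι κ ℤ → Matrix ι κ ℝ) :=
  Matrix.map_injective (Int.cast_injective (α := ℝ))

theorem realMatrix_mulVec {ι κ : Type*} [Fintype κ] (A : Matrix ι κ ℤ) (c : κ → ℤ) :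
    (realMatrix A *ᵥ fun i => (c i : ℝ)) = fun i => ((A *ᵥ c) i : ℝ) := by
  funext i
  simp [Matrix.mulVec, dotProduct]

theorem realMatrix_mul {ι κ μ : Type*} [Fintype κ] (A : Matrix ι κ ℤ) (B : Matrix κ μ ℤ) :
    realMatrix (A * B) = realMatrix A * realMatrix B :=
  Matrix.map_mul

section Hom

variable {n m k : ℕ} {D : PolType n} {E : PolType m} {H : PolType k}
  {X : MarkedAV.{u} D} {Y : MarkedAV.{u} E} {Z : MarkedAV.{u} H}

theorem toMatrix_lift (f : Hom X.torus Y.torus) :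
    LinearMap.toMatrix X.realBasis Y.realBasis (f.lift.restrictScalars ℝ) =
      realMatrix (homMatrix X Y f) := by
  ext i j
  rw [LinearMap.toMatrix_apply, LinearMap.restrictScalars_apply, X.realBasis_apply,
    ← f.coe_homology, Y.realBasis_repr, ← LinearMap.toMatrix_apply]
  rfl

theorem repr_lift (f : Hom X.torus Y.torus) (v : X.torus.V) :
    ⇑(Y.realBasis.repr (f.lift v)) = realMatrix (homMatrix X Y f) *ᵥ X.realBasis.repr v := by
  rw [← toMatrix_lift, LinearMap.toMatrix_mulVec_repr]
  rfl

/-- The rational representation is faithful. -/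
theorem hom_ext_matrix {f g : Hom X.torus Y.torus} (h : homMatrix X Y f = homMatrix X Y g) :
    f = g := by
  refine Hom.ext_fun fun x => ?_
  obtain ⟨v, rfl⟩ := X.torus.Λ.mkQ_surjective x
  have : f.lift v = g.lift v := by
    apply Y.realBasis.repr.injective
    apply DFunLike.coe_injective
    rw [repr_lift, repr_lift, h]
  have h1 := f.proj_lift v
  rw [this, g.proj_lift v] at h1
  exact h1.symm

theorem homMatrix_comp (g : Hom Y.torus Z.torus) (f : Hom X.torus Y.torus) :
    homMatrix X Z (g.comp f) = homMatrix Y Z g * homMatrix X Y f := by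
  rw [homMatrix, homMatrix, homMatrix, ← LinearMap.toMatrix_comp]
  congr 1
  exact LinearMap.ext fun x => Hom.homology_comp g f x

theorem homMatrix_id : homMatrix X X (Hom.id X.torus) = 1 := by
  have : (Hom.id X.torus).homology = LinearMap.id :=
    LinearMap.ext fun x => Hom.homology_of_eq_id _ (fun _ => rfl) x
  rw [homMatrix, this, LinearMap.toMatrix_id]

/-- The morphism of tori induced by a linear map of the universal coverings which preserves the
lattices. -/
def homOfLinear {X Y : ComplexTorus.{u}} (ρ : X.V →ₗ[ℂ] Y.V) (h : ∀ v ∈ X.Λ, ρ v ∈ Y.Λ) :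
    Hom X Y where
  toAddMonoidHom := (X.Λ.mapQ Y.Λ (ρ.restrictScalars ℤ) h).toAddMonoidHom
  holomorphic := fun _ => ⟨ρ, Filter.Eventually.of_forall fun _ =>
    ρ.toContinuousLinearMap.differentiableAt, Filter.Eventually.of_forall fun _ => rfl⟩

theorem homOfLinear_lift {X Y : ComplexTorus.{u}} (ρ : X.V →ₗ[ℂ] Y.V)
    (h : ∀ v ∈ X.Λ, ρ v ∈ Y.Λ) : (homOfLinear ρ h).lift = ρ :=
  lift_unique fun v => by rw [Hom.proj_lift]; rfl

/-- An integer matrix represents a morphism as soon as the real linear map it defines is complex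
linear. -/
theorem exists_hom_of_matrix (A : Matrix (SpIdx m) (SpIdx n) ℤ) (ρ : X.torus.V →ₗ[ℂ] Y.torus.V)
    (h : ∀ v, ⇑(Y.realBasis.repr (ρ v)) = realMatrix A *ᵥ X.realBasis.repr v) :
    ∃ f : Hom X.torus Y.torus, homMatrix X Y f = A := by
  have hρ : ∀ v ∈ X.torus.Λ, ρ v ∈ Y.torus.Λ := by
    intro v hv
    obtain ⟨c, hc⟩ := (X.mem_lattice_iff v).1 hv
    exact (Y.mem_lattice_iff _).2 ⟨A *ᵥ c, by rw [h, hc, realMatrix_mulVec]⟩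
  refine ⟨homOfLinear ρ hρ, realMatrix_injective ?_⟩
  rw [← toMatrix_lift, homOfLinear_lift]
  apply Matrix.toLin'.injective
  refine LinearMap.ext fun c => ?_
  obtain ⟨v, rfl⟩ := X.realBasis.equivFun.surjective c
  have := h v
  rw [Matrix.toLin'_apply, Matrix.toLin'_apply, Module.Basis.equivFun_apply, ← h,
    LinearMap.toMatrix_mulVec_repr]
  rfl

/-- Preserving the symplectic bases means having the identity matrix; the polarizations are then
preserved as well, since they have the same matrix. -/
theorem isMarkedIso_iff {X X₁ : MarkedAV.{u} D} {a : Hom X.torus X₁.torus} :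
    IsMarkedIso X X₁ a ↔ a.IsIso ∧ homMatrix X X₁ a = 1 := by
  constructor
  · rintro ⟨h1, -, h2⟩
    refine ⟨h1, ?_⟩
    ext i j
    rw [homMatrix, LinearMap.toMatrix_apply, h2, Module.Basis.repr_self, Matrix.one_apply,
      Finsupp.single_apply]
    simp only [eq_comm]
  · rintro ⟨h1, h2⟩
    have h3 : ∀ i, a.homology (X.basis i) = X₁.basis i := by
      intro i
      apply X₁.basis.repr.injective
      ext j
      rw [← LinearMap.toMatrix_apply]
      change homMatrix X X₁ a j i = _
      rw [h2, Module.Basis.repr_self, Matrix.one_apply, Finsupp.single_apply]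
      simp only [eq_comm]
    refine ⟨h1, fun x y => ?_, h3⟩
    have : X₁.form.compl₁₂ a.homology a.homology = X.form := by
      apply LinearMap.ext_basis X.basis X.basis
      intro i j
      rw [LinearMap.compl₁₂_apply, h3, h3, X₁.symplectic, X.symplectic]
    exact LinearMap.congr_fun₂ this x y

/-- Between varieties with symplectic bases of the same type, a pair of morphisms with identity
matrices is a pair of inverse isomorphisms. -/
theorem isMarkedIso_of_homMatrix_eq_one {X X₁ : MarkedAV.{u} D} {a : Hom X.torus X₁.torus}
    {b : Hom X₁.torus X.torus} (ha : homMatrix X X₁ a = 1) (hb : homMatrix X₁ X b = 1) :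
    IsMarkedIso X X₁ a := by
  refine isMarkedIso_iff.2 ⟨⟨b, fun x => ?_, fun y => ?_⟩, ha⟩
  · have : b.comp a = Hom.id _ := hom_ext_matrix (X := X) (Y := X)
      (by rw [homMatrix_comp (Y := X₁), ha, hb, homMatrix_id, one_mul])
    exact congrArg (fun f : Hom X.torus X.torus => f x) this
  · have : a.comp b = Hom.id _ := hom_ext_matrix (X := X₁) (Y := X₁)
      (by rw [homMatrix_comp (Y := X), ha, hb, homMatrix_id, one_mul])
    exact congrArg (fun f : Hom X₁.torus X₁.torus => f y) this

theorem comm_iff_homMatrix {X₁ : MarkedAV.{u} D} {Y₁ : MarkedAV.{u} E} {f : Hom X.torus Y.torus}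
    {f₁ : Hom X₁.torus Y₁.torus} {a : Hom X.torus X₁.torus} {b : Hom Y.torus Y₁.torus}
    (ha : homMatrix X X₁ a = 1) (hb : homMatrix Y Y₁ b = 1) :
    (∀ x, b (f x) = f₁ (a x)) ↔ homMatrix X Y f = homMatrix X₁ Y₁ f₁ := by
  constructor
  · intro h
    have : b.comp f = f₁.comp a := Hom.ext_fun h
    have := congrArg (homMatrix X Y₁) this
    rwa [homMatrix_comp (Y := Y), homMatrix_comp (Y := X₁), ha, hb, Matrix.one_mul,
      Matrix.mul_one] at this
  · intro h x
    have : b.comp f = f₁.comp a := hom_ext_matrix (X := X) (Y := Y₁)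
      (by rw [homMatrix_comp (Y := Y), homMatrix_comp (Y := X₁), ha, hb, h, Matrix.one_mul,
        Matrix.mul_one])
    exact congrArg (fun f : Hom X.torus Y₁.torus => f x) this

/-- The columns of an integer matrix generate a primitive sublattice: a real vector with integral
image is integral. -/
def IsPrimitive {ι κ : Type*} [Fintype κ] (A : Matrix ι κ ℤ) : Prop :=
  ∀ (r : κ → ℝ) (z : ι → ℤ), (realMatrix A *ᵥ r) = (fun i => (z i : ℝ)) →
    ∃ c : κ → ℤ, r = fun i => (c i : ℝ)

theorem injective_iff_isPrimitive (f : Hom X.torus Y.torus) :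
    Function.Injective f ↔ IsPrimitive (homMatrix X Y f) := by
  constructor
  · intro hf r z h
    obtain ⟨v, rfl⟩ := X.realBasis.equivFun.surjective r
    rw [Module.Basis.equivFun_apply] at h ⊢
    rw [← repr_lift] at h
    have h1 : f.lift v ∈ Y.torus.Λ := (Y.mem_lattice_iff _).2 ⟨z, h⟩
    rw [← proj_eq_zero, f.proj_lift, ← map_zero f.toAddMonoidHom] at h1
    exact (X.mem_lattice_iff v).1 (proj_eq_zero.1 (hf h1))
  · intro hf
    refine (injective_iff_map_eq_zero f.toAddMonoidHom).2 fun x hx => ?_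
    obtain ⟨v, rfl⟩ := X.torus.Λ.mkQ_surjective x
    have h1 : f.lift v ∈ Y.torus.Λ := by rw [← proj_eq_zero, f.proj_lift]; exact hx
    obtain ⟨z, hz⟩ := (Y.mem_lattice_iff _).1 h1
    rw [repr_lift] at hz
    exact proj_eq_zero.2 ((X.mem_lattice_iff v).2 (hf _ z hz))

end Hom

/-! ### Matrices of sums of complementary embeddings -/

theorem PolType.hat_det_ne_zero {n : ℕ} (D : PolType n) : D.hat.det ≠ 0 := by
  have hd : ∀ i, (D.d i : ℝ) ≠ 0 := fun i => by exact_mod_cast (D.pos i).ne'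
  have h : realMatrix D.hat * Matrix.fromBlocks 0 (-Matrix.diagonal fun i => (D.d i : ℝ)⁻¹)
      (Matrix.diagonal fun i => (D.d i : ℝ)⁻¹) 0 = 1 := by
    rw [PolType.hat, realMatrix, Matrix.fromBlocks_map, Matrix.fromBlocks_multiply,
      ← Matrix.fromBlocks_one]
    congr 1 <;> ext i j <;> simp [hd]
  intro h0
  apply Matrix.det_ne_zero_of_right_inverse h
  rw [realMatrix, ← RingHom.mapMatrix_apply, ← RingHom.map_det, h0, map_zero]

theorem realMatrix_smul_one {ι : Type*} [DecidableEq ι] (d : ℤ) :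
    realMatrix (d • (1 : Matrix ι ι ℤ)) = (d : ℝ) • 1 := by
  ext i j
  simp only [Matrix.map_apply, Matrix.smul_apply, Matrix.one_apply]
  split_ifs <;> simp

theorem realMatrix_mulVec_sumElim {ι κ κ' : Type*} [Fintype κ] [Fintype κ']
    (A : Matrix ι (κ ⊕ κ') ℤ) (r : κ → ℝ) (r' : κ' → ℝ) :
    realMatrix A *ᵥ Sum.elim r r' = realMatrix A.toCols₁ *ᵥ r + realMatrix A.toCols₂ *ᵥ r' := by
  rw [← Matrix.fromCols_toCols (realMatrix A), Matrix.fromCols_mulVec_sumElim]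
  rfl

/-- The numerical conditions on the matrix of a sum of complementary embeddings: the polarization
pulls back to the product polarization, and both blocks of columns are primitive. -/
structure IsComplementaryMatrix {n n' k : ℕ} (D : PolType n) (D' : PolType n') (E : PolType k)
    (M : Matrix (SpIdx k) (SpIdx n ⊕ SpIdx n') ℤ) : Prop where
  form : Matrix.fromBlocks D.hat 0 0 D'.hat = M.transpose * E.hat * M
  primitive : IsPrimitive M.toCols₁
  primitive' : IsPrimitive M.toCols₂

section Inverse

variable {n n' : ℕ} {D : PolType n} {D' : PolType n'} {E : PolType (n + n')}
  {M : Matrix (SpIdx (n + n')) (SpIdx n ⊕ SpIdx n') ℤ}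

/-- The compatibility with the (nondegenerate) forms makes `M` invertible over the rationals. -/
theorem exists_quasiInverse (h : Matrix.fromBlocks D.hat 0 0 D'.hat = M.transpose * E.hat * M) :
    ∃ (A : Matrix (SpIdx n ⊕ SpIdx n') (SpIdx (n + n')) ℤ) (d : ℤ), d ≠ 0 ∧ A * M = d • 1 := by
  refine ⟨(Matrix.fromBlocks D.hat 0 0 D'.hat).adjugate * (M.transpose * E.hat),
    (Matrix.fromBlocks D.hat 0 0 D'.hat).det, ?_, ?_⟩
  · rw [Matrix.det_fromBlocks_zero₂₁]
    exact mul_ne_zero D.hat_det_ne_zero D'.hat_det_ne_zero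
  · rw [Matrix.mul_assoc, ← h, Matrix.adjugate_mul]

theorem exists_realInverse (h : Matrix.fromBlocks D.hat 0 0 D'.hat = M.transpose * E.hat * M) :
    ∃ W : Matrix (SpIdx n ⊕ SpIdx n') (SpIdx (n + n')) ℝ,
      W * realMatrix M = 1 ∧ realMatrix M * W = 1 := by
  obtain ⟨A, d, hd, hA⟩ := exists_quasiInverse h
  have hd' : (d : ℝ) ≠ 0 := by exact_mod_cast hd
  have h1 : ((d : ℝ)⁻¹ • realMatrix A) * realMatrix M = 1 := by
    rw [Matrix.smul_mul, ← realMatrix_mul, hA, realMatrix_smul_one, smul_smul,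
      inv_mul_cancel₀ hd', one_smul]
  refine ⟨_, h1, (Matrix.mul_eq_one_comm_of_card_eq _ _ ℝ ?_).1 h1⟩
  simp only [Fintype.card_sum, Fintype.card_fin]
  omega

theorem matrix_eq_of_mul_right_eq {ι : Type*}
    (h : Matrix.fromBlocks D.hat 0 0 D'.hat = M.transpose * E.hat * M)
    {A B : Matrix ι (SpIdx (n + n')) ℤ} (hAB : A * M = B * M) : A = B := by
  obtain ⟨W, -, hW⟩ := exists_realInverse h
  apply realMatrix_injective
  rw [← Matrix.mul_one (realMatrix A), ← hW, ← Matrix.mul_assoc, ← realMatrix_mul, hAB,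
    realMatrix_mul, Matrix.mul_assoc, hW, Matrix.mul_one]

end Inverse

section Sum

variable {n n' k l : ℕ} {D : PolType n} {D' : PolType n'} {E : PolType k} {K : PolType l}
  {X : MarkedAV.{u} D} {X' : MarkedAV.{u} D'} {V : MarkedAV.{u} E} {W : MarkedAV.{u} K}
  {e : Hom X.torus V.torus} {e' : Hom X'.torus V.torus}

theorem repr_sum_lift (x : X.torus.V) (x' : X'.torus.V) :
    ⇑(V.realBasis.repr (e.lift x + e'.lift x')) =
      realMatrix (sumMatrix X X' V e e') *ᵥ
        Sum.elim (X.realBasis.repr x) (X'.realBasis.repr x') := by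
  rw [realMatrix_mulVec_sumElim, map_add, Finsupp.coe_add, repr_lift, repr_lift]
  rfl

/-- The pullback of the polarization under the sum, in terms of matrices. -/
theorem sum_form_eq_iff :
    (∀ x y x' y', V.form (e.homology x + e'.homology x') (e.homology y + e'.homology y') =
      X.form x y + X'.form x' y') ↔
    Matrix.fromBlocks D.hat 0 0 D'.hat =
      (sumMatrix X X' V e e').transpose * E.hat * sumMatrix X X' V e e' := by
  set b := X.basis.prod X'.basis with hb
  set s : X.torus.Λ × X'.torus.Λ →ₗ[ℤ] V.torus.Λ := e.homology.coprod e'.homology with hs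
  set B : X.torus.Λ × X'.torus.Λ →ₗ[ℤ] X.torus.Λ × X'.torus.Λ →ₗ[ℤ] ℤ :=
    X.form.compl₁₂ (LinearMap.fst ℤ _ _) (LinearMap.fst ℤ _ _) +
      X'.form.compl₁₂ (LinearMap.snd ℤ _ _) (LinearMap.snd ℤ _ _) with hB
  have h1 : LinearMap.toMatrix b V.basis s = sumMatrix X X' V e e' := by
    ext i (j | j) <;>
    simp [LinearMap.toMatrix_apply, hb, hs, sumMatrix, homMatrix]
  have h2 : LinearMap.toMatrix₂ V.basis V.basis V.form = E.hat := by
    ext i j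
    rw [LinearMap.toMatrix₂_apply, V.symplectic]
  have h3 : LinearMap.toMatrix₂ b b B = Matrix.fromBlocks D.hat 0 0 D'.hat := by
    ext (i | i) (j | j) <;>
    simp [LinearMap.toMatrix₂_apply, hb, hB, X.symplectic, X'.symplectic]
  have h4 := LinearMap.toMatrix₂_compl₁₂ V.basis V.basis b b V.form s s
  rw [h1, h2] at h4
  rw [← h3, ← h4, (LinearMap.toMatrix₂ b b).injective.eq_iff]
  constructor
  · intro h
    refine LinearMap.ext fun x => LinearMap.ext fun y => ?_
    exact (h x.1 y.1 x.2 y.2).symm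
  · intro h x y x' y'
    exact (LinearMap.congr_fun₂ h (x, x') (y, y')).symm

end Sum

section Sum

variable {n n' l : ℕ} {D : PolType n} {D' : PolType n'} {E : PolType (n + n')} {K : PolType l}
  {X : MarkedAV.{u} D} {X' : MarkedAV.{u} D'} {V : MarkedAV.{u} E} {W : MarkedAV.{u} K}
  {e : Hom X.torus V.torus} {e' : Hom X'.torus V.torus}

theorem exists_sum_lift_eq
    (h : Matrix.fromBlocks D.hat 0 0 D'.hat =
      (sumMatrix X X' V e e').transpose * E.hat * sumMatrix X X' V e e') (v : V.torus.V) :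
    ∃ x x', e.lift x + e'.lift x' = v := by
  obtain ⟨U, -, hU⟩ := exists_realInverse h
  set r := U *ᵥ V.realBasis.repr v with hr
  obtain ⟨x, hx⟩ := X.realBasis.equivFun.surjective fun i => r (Sum.inl i)
  obtain ⟨x', hx'⟩ := X'.realBasis.equivFun.surjective fun i => r (Sum.inr i)
  refine ⟨x, x', ?_⟩
  apply V.realBasis.repr.injective
  apply DFunLike.coe_injective
  rw [Module.Basis.equivFun_apply] at hx hx'
  rw [repr_sum_lift, hx, hx']
  have : Sum.elim (fun i => r (Sum.inl i)) (fun i => r (Sum.inr i)) = r := by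
    funext i; cases i <;> rfl
  rw [this, hr, Matrix.mulVec_mulVec, hU, Matrix.one_mulVec]

/-- The sum of two homomorphisms whose matrix is invertible over the rationals is an isogeny: it is
surjective since its linear lift is, and its kernel is a finitely generated torsion group. -/
theorem isIsogeny_sumHom
    (h : Matrix.fromBlocks D.hat 0 0 D'.hat =
      (sumMatrix X X' V e e').transpose * E.hat * sumMatrix X X' V e e') :
    IsIsogeny (sumHom e e') := by
  have hproj : ∀ x x', V.torus.proj (e.lift x + e'.lift x') =
      sumHom e e' (X.torus.proj x, X'.torus.proj x') := by
    intro x x'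
    rw [map_add, e.proj_lift, e'.proj_lift]
    rfl
  refine ⟨fun y => ?_, ?_⟩
  · obtain ⟨v, rfl⟩ := V.torus.Λ.mkQ_surjective y
    obtain ⟨x, x', rfl⟩ := exists_sum_lift_eq h v
    exact ⟨_, (hproj x x').symm⟩
  · obtain ⟨A, d, hd, hA⟩ := exists_quasiInverse h
    have hlat : ∀ x x', e.lift x + e'.lift x' ∈ V.torus.Λ →
        d • x ∈ X.torus.Λ ∧ d • x' ∈ X'.torus.Λ := by
      intro x x' hx
      obtain ⟨z, hz⟩ := (V.mem_lattice_iff _).1 hx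
      rw [repr_sum_lift] at hz
      have h1 := congrArg (realMatrix A *ᵥ ·) hz
      rw [Matrix.mulVec_mulVec, ← realMatrix_mul, hA, realMatrix_smul_one, Matrix.smul_mulVec,
        Matrix.one_mulVec, realMatrix_mulVec] at h1
      refine ⟨(X.mem_lattice_iff _).2 ⟨fun i => (A *ᵥ z) (Sum.inl i), funext fun i => ?_⟩,
        (X'.mem_lattice_iff _).2 ⟨fun i => (A *ᵥ z) (Sum.inr i), funext fun i => ?_⟩⟩
      · rw [← congrFun h1, ← Int.cast_smul_eq_zsmul ℝ]
        simp
      · rw [← congrFun h1, ← Int.cast_smul_eq_zsmul ℝ]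
        simp
    have hfg : Module.Finite ℤ (sumHom e e').ker := by
      set s : X.torus.V × X'.torus.V →ₗ[ℤ] V.torus.V :=
        (e.lift.coprod e'.lift).restrictScalars ℤ with hs
      have hinj : Function.Injective s := by
        obtain ⟨U, hU, -⟩ := exists_realInverse h
        refine (injective_iff_map_eq_zero s).2 ?_
        rintro ⟨x, x'⟩ hx
        have h1 : e.lift x + e'.lift x' = 0 := hx
        have h2 := repr_sum_lift (e := e) (e' := e') x x'
        rw [h1, map_zero, Finsupp.coe_zero] at h2
        have h3 := congrArg (U *ᵥ ·) h2
        rw [Matrix.mulVec_mulVec, hU, Matrix.one_mulVec, Matrix.mulVec_zero] at h3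
        refine Prod.ext (X.realBasis.ext_elem fun i => ?_) (X'.realBasis.ext_elem fun i => ?_)
        · simpa using (congrFun h3 (Sum.inl i)).symm
        · simpa using (congrFun h3 (Sum.inr i)).symm
      have hsurj : Function.Surjective s := fun v => by
        obtain ⟨x, x', hx⟩ := exists_sum_lift_eq h v
        exact ⟨(x, x'), hx⟩
      have hG : (V.torus.Λ.comap s).FG := by
        refine Submodule.fg_of_fg_map_injective s hinj ?_
        rw [Submodule.map_comap_eq_of_surjective hsurj]
        exact Module.Finite.iff_fg.1 (Module.Finite.of_basis V.basis)
      have hker : AddSubgroup.toIntSubmodule (sumHom e e').ker =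
          (V.torus.Λ.comap s).map (X.torus.Λ.mkQ.prodMap X'.torus.Λ.mkQ) := by
        ext ⟨y, y'⟩
        obtain ⟨x, rfl⟩ := X.torus.Λ.mkQ_surjective y
        obtain ⟨x', rfl⟩ := X'.torus.Λ.mkQ_surjective y'
        constructor
        · intro hy
          refine ⟨(x, x'), ?_, rfl⟩
          change e.lift x + e'.lift x' ∈ V.torus.Λ
          rw [← proj_eq_zero, hproj]
          exact hy
        · rintro ⟨⟨w, w'⟩, hw, hww⟩
          rw [← hww]
          change sumHom e e' (X.torus.proj w, X'.torus.proj w') = 0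
          rw [← hproj]
          exact proj_eq_zero.2 hw
      have := hG.map (X.torus.Λ.mkQ.prodMap X'.torus.Λ.mkQ)
      rw [← hker] at this
      exact Module.Finite.iff_fg.2 this
    refine Module.finite_of_fg_torsion _ fun {y} => ?_
    obtain ⟨⟨y, y'⟩, hy⟩ := y
    obtain ⟨x, rfl⟩ := X.torus.Λ.mkQ_surjective y
    obtain ⟨x', rfl⟩ := X'.torus.Λ.mkQ_surjective y'
    refine ⟨⟨d, mem_nonZeroDivisors_of_ne_zero hd⟩, ?_⟩
    have h2 : e.lift x + e'.lift x' ∈ V.torus.Λ := by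
      rw [← proj_eq_zero, hproj]; exact hy
    obtain ⟨h3, h4⟩ := hlat x x' h2
    apply Subtype.ext
    apply Prod.ext
    · change d • X.torus.proj x = 0
      rw [← map_zsmul]
      exact proj_eq_zero.2 h3
    · change d • X'.torus.proj x' = 0
      rw [← map_zsmul]
      exact proj_eq_zero.2 h4

/-- An integer matrix on `H_1(V)` represents a morphism as soon as its composites with the two
summands do: the linear lifts of the summands span the universal covering of `V`, so that the real
linear map defined by the matrix is complex linear. -/
theorem exists_hom_of_sum
    (h : Matrix.fromBlocks D.hat 0 0 D'.hat =
      (sumMatrix X X' V e e').transpose * E.hat * sumMatrix X X' V e e')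
    (A : Matrix (SpIdx l) (SpIdx (n + n')) ℤ) (a : Hom X.torus W.torus) (a' : Hom X'.torus W.torus)
    (hA : A * sumMatrix X X' V e e' = sumMatrix X X' W a a') :
    ∃ f : Hom V.torus W.torus, homMatrix V W f = A := by
  set ρ : V.torus.V →ₗ[ℝ] W.torus.V :=
    Matrix.toLin V.realBasis W.realBasis (realMatrix A) with hρ
  have hrepr : ∀ v, ⇑(W.realBasis.repr (ρ v)) = realMatrix A *ᵥ V.realBasis.repr v := by
    intro v
    rw [← LinearMap.toMatrix_mulVec_repr V.realBasis, hρ, LinearMap.toMatrix_toLin]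
  have hsum : ∀ x x', ρ (e.lift x + e'.lift x') = a.lift x + a'.lift x' := by
    intro x x'
    apply W.realBasis.repr.injective
    apply DFunLike.coe_injective
    rw [hrepr, repr_sum_lift, repr_sum_lift, Matrix.mulVec_mulVec, ← realMatrix_mul, hA]
  have hsmul : ∀ (c : ℂ) v, ρ (c • v) = c • ρ v := by
    intro c v
    obtain ⟨x, x', rfl⟩ := exists_sum_lift_eq h v
    rw [smul_add, ← map_smul, ← map_smul, hsum, hsum, map_smul, map_smul, smul_add]
  exact exists_hom_of_matrix A ⟨ρ.toAddHom, hsmul⟩ hrepr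

/-- A pair of homomorphisms is a sum of complementary embeddings if and only if its matrix satisfies
the numerical conditions. -/
theorem isComplementarySum_iff :
    IsComplementarySum X X' V e e' ↔ IsComplementaryMatrix D D' E (sumMatrix X X' V e e') := by
  have h1 : (sumMatrix X X' V e e').toCols₁ = homMatrix X V e := rfl
  have h2 : (sumMatrix X X' V e e').toCols₂ = homMatrix X' V e' := rfl
  constructor
  · intro h
    exact ⟨sum_form_eq_iff.1 h.form_eq, h1 ▸ (injective_iff_isPrimitive e).1 h.injective,
      h2 ▸ (injective_iff_isPrimitive e').1 h.injective'⟩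
  · intro h
    exact ⟨(injective_iff_isPrimitive e).2 (h1 ▸ h.primitive),
      (injective_iff_isPrimitive e').2 (h2 ▸ h.primitive'), isIsogeny_sumHom h.form,
      sum_form_eq_iff.2 h.form⟩

end Sum

/-! ### Gluing two varieties along a complementary matrix -/

section Glue

variable {n n' : ℕ} {D : PolType n} {D' : PolType n'} (X : MarkedAV.{u} D) (X' : MarkedAV.{u} D')

/-- The real basis of the universal covering of `X × X'` in which a vector has the coordinates
`M r`, where `r` is the vector of its coordinates in the symplectic bases of `X` and `X'`. -/
noncomputable def glueBasis {k : ℕ} {M : Matrix (SpIdx k) (SpIdx n ⊕ SpIdx n') ℝ}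
    {U : Matrix (SpIdx n ⊕ SpIdx n') (SpIdx k) ℝ} (hUM : U * M = 1) (hMU : M * U = 1) :
    Module.Basis (SpIdx k) ℝ (X.torus.V × X'.torus.V) :=
  .ofEquivFun ((X.realBasis.prod X'.realBasis).equivFun ≪≫ₗ Matrix.toLin'OfInv hUM hMU)

theorem glueBasis_repr {k : ℕ} {M : Matrix (SpIdx k) (SpIdx n ⊕ SpIdx n') ℝ}
    {U : Matrix (SpIdx n ⊕ SpIdx n') (SpIdx k) ℝ} (hUM : U * M = 1) (hMU : M * U = 1)
    (w : X.torus.V × X'.torus.V) :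
    ⇑((glueBasis X X' hUM hMU).repr w) =
      M *ᵥ Sum.elim (X.realBasis.repr w.1) (X'.realBasis.repr w.2) := by
  have h1 : ⇑((X.realBasis.prod X'.realBasis).repr w) =
      Sum.elim (X.realBasis.repr w.1) (X'.realBasis.repr w.2) := by
    funext i
    cases i <;> simp
  rw [← h1]
  rfl

/-- The imaginary part of a form which is linear in the first and conjugate linear in the second
variable, as a real bilinear form. -/
noncomputable def imForm {V : Type*} [AddCommGroup V] [Module ℂ V]
    (h : V →ₗ[ℂ] V →ₗ⋆[ℂ] ℂ) : V →ₗ[ℝ] V →ₗ[ℝ] ℝ :=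
  LinearMap.mk₂ ℝ (fun x y => (h x y).im) (by intros; simp) (by
    intro c x y
    rw [← Complex.coe_smul, map_smul]
    simp) (by intros; simp) (by
    intro c x y
    rw [← Complex.coe_smul, LinearMap.map_smulₛₗ]
    simp)

theorem imForm_apply {V : Type*} [AddCommGroup V] [Module ℂ V]
    (h : V →ₗ[ℂ] V →ₗ⋆[ℂ] ℂ) (x y : V) : imForm h x y = (h x y).im := rfl

/-- The orthogonal sum of two sesquilinear forms. -/
noncomputable def prodHermitian {V V' : Type*} [AddCommGroup V] [Module ℂ V] [AddCommGroup V']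
    [Module ℂ V'] (h : V →ₗ[ℂ] V →ₗ⋆[ℂ] ℂ) (h' : V' →ₗ[ℂ] V' →ₗ⋆[ℂ] ℂ) :
    V × V' →ₗ[ℂ] V × V' →ₗ⋆[ℂ] ℂ :=
  LinearMap.mk₂'ₛₗ (RingHom.id ℂ) (starRingEnd ℂ) (fun x y => h x.1 y.1 + h' x.2 y.2)
    (by intros; simp; ring) (by intros; simp; ring) (by intros; simp; ring)
    (by intros; simp [LinearMap.map_smulₛₗ]; ring)

theorem prodHermitian_apply {V V' : Type*} [AddCommGroup V] [Module ℂ V] [AddCommGroup V']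
    [Module ℂ V'] (h : V →ₗ[ℂ] V →ₗ⋆[ℂ] ℂ) (h' : V' →ₗ[ℂ] V' →ₗ⋆[ℂ] ℂ) (x y : V × V') :
    prodHermitian h h' x y = h x.1 y.1 + h' x.2 y.2 := rfl

variable {E : PolType (n + n')} {M : Matrix (SpIdx (n + n')) (SpIdx n ⊕ SpIdx n') ℤ}

/-- Any two varieties with symplectic bases are the summands of a variety whose sum map has a given
matrix satisfying the numerical conditions. -/
theorem exists_complementarySum (hM : IsComplementaryMatrix D D' E M) :
    ∃ (V : MarkedAV.{u} E) (e : Hom X.torus V.torus) (e' : Hom X'.torus V.torus),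
      sumMatrix X X' V e e' = M := by
  obtain ⟨U, hUM, hMU⟩ := exists_realInverse hM.form
  set v := glueBasis X X' hUM hMU with hv
  have hrepr : ∀ w, ⇑(v.repr w) =
      realMatrix M *ᵥ Sum.elim (X.realBasis.repr w.1) (X'.realBasis.repr w.2) :=
    glueBasis_repr X X' hUM hMU
  let T : ComplexTorus.{u} :=
    { V := X.torus.V × X'.torus.V
      Λ := Submodule.span ℤ (Set.range v)
      span_eq_top := by
        have := (inferInstance : IsZLattice ℝ (Submodule.span ℤ (Set.range v)))
        exact this.span_top }
  let b : Module.Basis (SpIdx (n + n')) ℤ T.Λ := v.restrictScalars ℤ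
  have hb : ∀ i, (b i : X.torus.V × X'.torus.V) = v i := fun i => v.restrictScalars_apply ℤ i
  let L : T.Λ →ₗ[ℤ] T.Λ →ₗ[ℤ] ℤ := Matrix.toLinearMap₂ b b E.hat
  have hL : ∀ i j, L (b i) (b j) = E.hat i j := fun i j => by
    rw [← LinearMap.toMatrix₂_apply, LinearMap.toMatrix₂_toLinearMap₂]
  have hpol : T.IsPolarization L := by
    obtain ⟨h, h1, h2, h3⟩ := X.polarization
    obtain ⟨h', h1', h2', h3'⟩ := X'.polarization
    refine ⟨prodHermitian h h', fun x y => ?_, fun x hx => ?_, ?_⟩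
    · rw [prodHermitian_apply, prodHermitian_apply, h1, h1', map_add]
    · rw [prodHermitian_apply, Complex.add_re]
      have h0 : ∀ x, 0 ≤ (h x x).re := fun x => by
        rcases eq_or_ne x 0 with rfl | hx
        · simp
        · exact (h2 x hx).le
      have h0' : ∀ x, 0 ≤ (h' x x).re := fun x => by
        rcases eq_or_ne x 0 with rfl | hx
        · simp
        · exact (h2' x hx).le
      by_cases hx1 : x.1 = 0
      · have hx2 : x.2 ≠ 0 := fun hx2 => hx (Prod.ext hx1 hx2)
        exact add_pos_of_nonneg_of_pos (h0 _) (h2' _ hx2)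
      · exact add_pos_of_pos_of_nonneg (h2 _ hx1) (h0' _)
    · set x := X.realBasis.prod X'.realBasis with hx
      set B := imForm (prodHermitian h h') with hB
      have hBx : LinearMap.toMatrix₂ x x B =
          realMatrix (Matrix.fromBlocks D.hat 0 0 D'.hat) := by
        ext (i | i) (j | j) <;>
        simp [LinearMap.toMatrix₂_apply, hx, hB, imForm_apply, prodHermitian_apply,
          ← h3, ← h3', X.symplectic, X'.symplectic]
      have hid : LinearMap.toMatrix x v LinearMap.id = realMatrix M := by
        apply Matrix.toLin'.injective
        refine LinearMap.ext fun c => ?_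
        obtain ⟨w, rfl⟩ := x.equivFun.surjective c
        rw [Matrix.toLin'_apply, Matrix.toLin'_apply, Module.Basis.equivFun_apply,
          LinearMap.toMatrix_mulVec_repr, LinearMap.id_apply, hrepr]
        congr 1
      -- Change of basis turns the product form into `Mᵀ B M`, and `M` is invertible over `ℝ`.
      have hBv : LinearMap.toMatrix₂ v v B = realMatrix E.hat := by
        have h4 := LinearMap.toMatrix₂_compl₁₂ v v x x B LinearMap.id LinearMap.id
        rw [LinearMap.compl₁₂_id_id, hid, hBx, hM.form, realMatrix_mul, realMatrix_mul] at h4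
        have h5 := congrArg (fun A => U.transpose * A * U) h4
        have hUM' : U.transpose * (realMatrix M).transpose = 1 := by
          rw [← Matrix.transpose_mul, hMU, Matrix.transpose_one]
        simp only [Matrix.mul_assoc, hMU, Matrix.mul_one] at h5
        rw [← Matrix.mul_assoc, ← Matrix.mul_assoc, hUM', Matrix.one_mul] at h5
        rw [← h5, show realMatrix M.transpose = (realMatrix M).transpose from rfl, hUM',
          Matrix.one_mul]
      have hLB : ∀ i j, (L (b i) (b j) : ℝ) = B (b i) (b j) := fun i j => by
        rw [hL, hb, hb, ← LinearMap.toMatrix₂_apply v v, hBv]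
        rfl
      intro y z
      change ((L y z : ℤ) : ℝ) = B y z
      rw [← b.sum_repr y, ← b.sum_repr z]
      simp only [map_sum, LinearMap.sum_apply, map_zsmul, LinearMap.smul_apply,
        Submodule.coe_sum, Submodule.coe_smul, Int.cast_sum, smul_eq_mul, Int.cast_mul, hLB,
        zsmul_eq_mul]
  let V : MarkedAV.{u} E := ⟨T, L, hpol, b, hL⟩
  have hV : V.realBasis = v := by
    apply Module.Basis.eq_of_apply_eq
    intro i
    rw [V.realBasis_apply]
    exact hb i
  have hinl : ∀ w, ⇑(v.repr (w, 0)) = realMatrix M.toCols₁ *ᵥ X.realBasis.repr w := fun w => by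
    rw [hrepr, realMatrix_mulVec_sumElim]
    simp
  have hinr : ∀ w, ⇑(v.repr (0, w)) = realMatrix M.toCols₂ *ᵥ X'.realBasis.repr w := fun w => by
    rw [hrepr, realMatrix_mulVec_sumElim]
    simp
  obtain ⟨e, he⟩ := exists_hom_of_matrix (X := X) (Y := V) M.toCols₁
    (LinearMap.inl ℂ X.torus.V X'.torus.V) (fun w => by
      rw [hV]
      exact hinl w)
  obtain ⟨e', he'⟩ := exists_hom_of_matrix (X := X') (Y := V) M.toCols₂
    (LinearMap.inr ℂ X.torus.V X'.torus.V) (fun w => by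
      rw [hV]
      exact hinr w)
  refine ⟨V, e, e', ?_⟩
  rw [sumMatrix, he, he', Matrix.fromCols_toCols]

end Glue

/-! ### Types of morphisms -/

section Diagram

variable {n n' : ℕ} {D : PolType n} {D' : PolType n'} {E : PolType (n + n')}
  {M : Matrix (SpIdx (n + n')) (SpIdx n ⊕ SpIdx n') ℤ} {R : Matrix (SpIdx n) (SpIdx n) ℤ}
  {R' : Matrix (SpIdx n') (SpIdx n') ℤ}

theorem realMatrix_mulVec_injective
    (h : Matrix.fromBlocks D.hat 0 0 D'.hat = M.transpose * E.hat * M) :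
    Function.Injective (realMatrix M).mulVec := by
  obtain ⟨U, hU, -⟩ := exists_realInverse h
  intro r s hrs
  have h1 := congrArg (U *ᵥ ·) hrs
  rwa [Matrix.mulVec_mulVec, hU, Matrix.one_mulVec, Matrix.mulVec_mulVec, hU,
    Matrix.one_mulVec] at h1

/-- In a diagram with exact rows as in the definition, both blocks of columns of `M` are
primitive: an integral vector in the real span of one block has zero component in the other, hence
zero image in `F`, hence it comes from an integral vector. -/
theorem EmbeddingDiagram.isComplementaryMatrix (hd : EmbeddingDiagram M R R')
    (h : Matrix.fromBlocks D.hat 0 0 D'.hat = M.transpose * E.hat * M) :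
    IsComplementaryMatrix D D' E M := by
  obtain ⟨F, _, p, q, q', S, ⟨-, hMp, -⟩, -, -, hSM, hS, -⟩ := hd
  have hSM' : ∀ (r : SpIdx n ⊕ SpIdx n' → ℝ) (z : SpIdx (n + n') → ℤ),
      realMatrix M *ᵥ r = (fun i => (z i : ℝ)) →
      (fun i => ((S *ᵥ z) i : ℝ)) = realMatrix (Matrix.fromBlocks R 0 0 R') *ᵥ r := by
    intro r z hr
    rw [← hSM, realMatrix_mul, ← Matrix.mulVec_mulVec, hr, realMatrix_mulVec]
  have hfac : ∀ (r : SpIdx n ⊕ SpIdx n' → ℝ) (z : SpIdx (n + n') → ℤ),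
      realMatrix M *ᵥ r = (fun i => (z i : ℝ)) → p z = 0 →
      ∃ c : SpIdx n ⊕ SpIdx n' → ℤ, r = fun i => (c i : ℝ) := by
    intro r z hr hz
    obtain ⟨c, hc⟩ := (hMp z).1 hz
    refine ⟨c, realMatrix_mulVec_injective h ?_⟩
    rw [hr, realMatrix_mulVec, hc]
  have hdiag : ∀ r r', realMatrix (Matrix.fromBlocks R 0 0 R') *ᵥ Sum.elim r r' =
      Sum.elim (realMatrix R *ᵥ r) (realMatrix R' *ᵥ r') := by
    intro r r'
    rw [realMatrix, Matrix.fromBlocks_map, Matrix.fromBlocks_mulVec]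
    simp [realMatrix]
  refine ⟨h, fun r z hr => ?_, fun r z hr => ?_⟩
  · have h1 : realMatrix M *ᵥ Sum.elim r 0 = fun i => (z i : ℝ) := by
      rw [realMatrix_mulVec_sumElim, Matrix.mulVec_zero, add_zero, hr]
    have h2 := hSM' _ _ h1
    rw [hdiag, Matrix.mulVec_zero] at h2
    have h3 : (fun i => (S *ᵥ z) (Sum.inr i)) = 0 := by
      funext i
      have := congrFun h2 (Sum.inr i)
      simpa using this
    have h4 : p z = 0 := by rw [← (hS z).2, h3, map_zero]
    obtain ⟨c, hc⟩ := hfac _ _ h1 h4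
    exact ⟨fun i => c (Sum.inl i), funext fun i => congrFun hc (Sum.inl i)⟩
  · have h1 : realMatrix M *ᵥ Sum.elim 0 r = fun i => (z i : ℝ) := by
      rw [realMatrix_mulVec_sumElim, Matrix.mulVec_zero, zero_add, hr]
    have h2 := hSM' _ _ h1
    rw [hdiag, Matrix.mulVec_zero] at h2
    have h3 : (fun i => (S *ᵥ z) (Sum.inl i)) = 0 := by
      funext i
      have := congrFun h2 (Sum.inl i)
      simpa using this
    have h4 : p z = 0 := by rw [← (hS z).1, h3, map_zero]
    obtain ⟨c, hc⟩ := hfac _ _ h1 h4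
    exact ⟨fun i => c (Sum.inr i), funext fun i => congrFun hc (Sum.inr i)⟩

/-- The integer matrix `P̄ S`, with `S` the first component of the vertical map of the diagram,
extends `P × 0` to the overlattice. -/
theorem EmbeddingDiagram.exists_extension (hd : EmbeddingDiagram M R R')
    (Pbar : Matrix (SpIdx n) (SpIdx n) ℤ) :
    ∃ G : Matrix (SpIdx n) (SpIdx (n + n')) ℤ, G * M = Matrix.fromCols (Pbar * R) 0 := by
  obtain ⟨F, _, p, q, q', S, -, -, -, hSM, -, -⟩ := hd
  refine ⟨Pbar * S.toRows₁, ?_⟩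
  have : S.toRows₁ * M = Matrix.fromCols R 0 := by
    have h1 : S.toRows₁ * M = (S * M).toRows₁ := rfl
    rw [h1, hSM]
    ext i (j | j) <;> rfl
  rw [Matrix.mul_assoc, this, Matrix.mul_fromCols, Matrix.mul_zero]

end Diagram

/-! ### Morphisms with decomposition in terms of matrices -/

section Comm

variable {n m : ℕ} {D : PolType n} {H : PolType m} {X : MarkedAV.{u} D} {Y : MarkedAV.{u} H}

theorem homMatrix_eq_zero_iff {f : Hom X.torus Y.torus} :
    homMatrix X Y f = 0 ↔ ∀ x, f x = 0 := by
  constructor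
  · intro h x
    obtain ⟨v, rfl⟩ := X.torus.Λ.mkQ_surjective x
    rw [← f.proj_lift, proj_eq_zero, Y.mem_lattice_iff]
    refine ⟨0, ?_⟩
    rw [repr_lift, h]
    funext i
    simp [realMatrix]
  · intro h
    have : f.homology = 0 := LinearMap.ext fun x => Subtype.ext
      (f.homology_eq 0 (fun v => by rw [h, LinearMap.zero_apply, map_zero]) x)
    rw [homMatrix, this, map_zero]

theorem exists_homMatrix_eq_zero (X : MarkedAV.{u} D) (Y : MarkedAV.{u} H) :
    ∃ f : Hom X.torus Y.torus, homMatrix X Y f = 0 := by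
  refine exists_hom_of_matrix (X := X) (Y := Y) 0 0 fun v => ?_
  funext i
  simp [realMatrix]

variable {n' m' k l : ℕ} {D' : PolType n'} {H' : PolType m'} {E : PolType k} {K : PolType l}
  {X' : MarkedAV.{u} D'} {Y' : MarkedAV.{u} H'} {V : MarkedAV.{u} E} {W : MarkedAV.{u} K}

theorem comm_iff_matrix {f : Hom V.torus W.torus} {e : Hom X.torus V.torus}
    {e' : Hom X'.torus V.torus} {ε : Hom Y.torus W.torus} {ε' : Hom Y'.torus W.torus}
    {g : Hom X.torus Y.torus} :
    (∀ x x', f (sumHom e e' (x, x')) = sumHom ε ε' (g x, 0)) ↔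
      homMatrix V W f * sumMatrix X X' V e e' =
        Matrix.fromCols (homMatrix Y W ε * homMatrix X Y g) 0 := by
  rw [sumMatrix, Matrix.mul_fromCols, Matrix.fromCols_inj.eq_iff,
    ← homMatrix_comp (X := X) (Y := V), ← homMatrix_comp (X := X') (Y := V),
    ← homMatrix_comp (X := X) (Y := Y), homMatrix_eq_zero_iff]
  constructor
  · intro h
    constructor
    · congr 1
      refine Hom.ext_fun fun x => ?_
      change f (e x) = ε (g x)
      simpa using h x 0
    · intro x'
      change f (e' x') = 0
      simpa using h 0 x'
  · rintro ⟨h1, h2⟩ x x'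
    have h3 : f (e x) = ε (g x) := congrArg (fun a : Hom X.torus W.torus => a x)
      (hom_ext_matrix (X := X) (Y := W) h1)
    have h4 : f (e' x') = 0 := h2 x'
    simp [h3, h4]

end Comm

/-- Sums of complementary embeddings with the same matrix and isomorphic summands have isomorphic
targets: the identity matrix represents an isomorphism. -/
theorem exists_isMarkedIso_of_sum {n n' : ℕ} {D : PolType n} {D' : PolType n'}
    {E : PolType (n + n')} {X X₁ : MarkedAV.{u} D} {X' X'₁ : MarkedAV.{u} D'}
    {V V₁ : MarkedAV.{u} E} {e : Hom X.torus V.torus} {e' : Hom X'.torus V.torus}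
    {e₁ : Hom X₁.torus V₁.torus} {e'₁ : Hom X'₁.torus V₁.torus}
    {a : Hom X.torus X₁.torus} {a' : Hom X'.torus X'₁.torus}
    (hM : IsComplementaryMatrix D D' E (sumMatrix X X' V e e'))
    (h : sumMatrix X X' V e e' = sumMatrix X₁ X'₁ V₁ e₁ e'₁)
    (ha : IsMarkedIso X X₁ a) (ha' : IsMarkedIso X' X'₁ a') :
    ∃ b : Hom V.torus V₁.torus, IsMarkedIso V V₁ b ∧ homMatrix V V₁ b = 1 := by
  have key : ∀ {X X₁ : MarkedAV.{u} D} {X' X'₁ : MarkedAV.{u} D'} {V V₁ : MarkedAV.{u} E}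
      {e : Hom X.torus V.torus} {e' : Hom X'.torus V.torus} {e₁ : Hom X₁.torus V₁.torus}
      {e'₁ : Hom X'₁.torus V₁.torus} {a : Hom X.torus X₁.torus} {a' : Hom X'.torus X'₁.torus},
      IsComplementaryMatrix D D' E (sumMatrix X X' V e e') →
      sumMatrix X X' V e e' = sumMatrix X₁ X'₁ V₁ e₁ e'₁ →
      IsMarkedIso X X₁ a → IsMarkedIso X' X'₁ a' →
      ∃ b : Hom V.torus V₁.torus, homMatrix V V₁ b = 1 := by
    intro X X₁ X' X'₁ V V₁ e e' e₁ e'₁ a a' hM h ha ha'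
    refine exists_hom_of_sum hM.form 1 (e₁.comp a) (e'₁.comp a') ?_
    rw [Matrix.one_mul, h, sumMatrix, sumMatrix, homMatrix_comp (Y := X₁),
      homMatrix_comp (Y := X'₁), (isMarkedIso_iff.1 ha).2, (isMarkedIso_iff.1 ha').2,
      Matrix.mul_one, Matrix.mul_one]
  obtain ⟨c, hc, -⟩ := ha.exists_inv
  obtain ⟨c', hc', -⟩ := ha'.exists_inv
  obtain ⟨b, hb⟩ := key hM h ha ha'
  obtain ⟨b', hb'⟩ := key (h ▸ hM) h.symm hc hc'
  exact ⟨b, isMarkedIso_of_homMatrix_eq_one hb hb', hb⟩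

/-- The consequences of being a type of morphisms which determine the moduli of morphisms: the
matrices of the sums are complementary, and `N (P × 0) M⁻¹` is an integer matrix. -/
structure IsMorphismType {n n' m' : ℕ} (δ : MorPolType n n' m') (τ : MorMatrices n n' m') :
    Prop where
  source : IsComplementaryMatrix δ.D δ.D' δ.E τ.M
  target : IsComplementaryMatrix δ.H δ.H' δ.K τ.N
  extension : ∃ G : Matrix (SpIdx (n + m')) (SpIdx (n + n')) ℤ,
    G * τ.M = Matrix.fromCols (τ.N.toCols₁ * τ.P) 0

section Types

variable {n n' m' : ℕ} {δ : MorPolType n n' m'} {τ : MorMatrices n n' m'}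

theorem TypeConditions.isMorphismType (h : TypeConditions δ τ) : IsMorphismType δ τ := by
  obtain ⟨R, R', hd, Pbar, hP⟩ := h.source_diagram
  obtain ⟨Q, Q', hd'⟩ := h.target_diagram
  obtain ⟨G, hG⟩ := hd.exists_extension Pbar
  refine ⟨hd.isComplementaryMatrix h.source_form, hd'.isComplementaryMatrix h.target_form,
    τ.N.toCols₁ * G, ?_⟩
  rw [Matrix.mul_assoc, hG, Matrix.mul_fromCols, Matrix.mul_zero, hP]

theorem MarkedMorphism.isMorphismType (S : MarkedMorphism.{u} δ) :
    IsMorphismType δ ⟨sumMatrix S.X S.X' S.V S.e S.e', sumMatrix S.Y S.Y' S.W S.ε S.ε',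
      homMatrix S.X S.Y S.g⟩ :=
  ⟨isComplementarySum_iff.1 S.source_sum, isComplementarySum_iff.1 S.target_sum,
    homMatrix S.V S.W S.f, comm_iff_matrix.1 S.comm⟩

theorem isMorphismType_of_nonempty (h : (morphismFibre.{u} δ τ).Nonempty) :
    IsMorphismType δ τ := by
  obtain ⟨c, hc⟩ := h
  induction c using Quotient.inductionOn with
  | h S =>
    change _ = τ at hc
    rw [← hc]
    exact S.isMorphismType

/-- Two morphisms with the same matrices, the same isogeny `X → Y` and the same complements `X'`,
`Y'` up to isomorphism are isomorphic. -/
theorem MarkedMorphism.nonempty_iso {S T : MarkedMorphism.{u} δ}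
    (hM : sumMatrix S.X S.X' S.V S.e S.e' = sumMatrix T.X T.X' T.V T.e T.e')
    (hN : sumMatrix S.Y S.Y' S.W S.ε S.ε' = sumMatrix T.Y T.Y' T.W T.ε T.ε')
    {aX : Hom S.X.torus T.X.torus} {aY : Hom S.Y.torus T.Y.torus}
    {aX' : Hom S.X'.torus T.X'.torus} {aY' : Hom S.Y'.torus T.Y'.torus}
    (hX : IsMarkedIso S.X T.X aX) (hY : IsMarkedIso S.Y T.Y aY)
    (hX' : IsMarkedIso S.X' T.X' aX') (hY' : IsMarkedIso S.Y' T.Y' aY')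
    (hg : ∀ x, aY (S.g x) = T.g (aX x)) : Nonempty (MarkedMorphism.Iso S T) := by
  have hS := S.isMorphismType
  obtain ⟨aV, hV, hV1⟩ := exists_isMarkedIso_of_sum hS.source hM hX hX'
  obtain ⟨aW, hW, hW1⟩ := exists_isMarkedIso_of_sum hS.target hN hY hY'
  have hX1 := (isMarkedIso_iff.1 hX).2
  have hY1 := (isMarkedIso_iff.1 hY).2
  have hX1' := (isMarkedIso_iff.1 hX').2
  have hY1' := (isMarkedIso_iff.1 hY').2
  obtain ⟨he, he'⟩ := Matrix.fromCols_inj.eq_iff.1 hM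
  obtain ⟨hε, hε'⟩ := Matrix.fromCols_inj.eq_iff.1 hN
  refine ⟨⟨aX, aX', aV, aY, aY', aW, hX, hX', hV, hY, hY', hW,
    (comm_iff_homMatrix hX1 hV1).2 he, (comm_iff_homMatrix hX1' hV1).2 he',
    (comm_iff_homMatrix hY1 hW1).2 hε, (comm_iff_homMatrix hY1' hW1).2 hε', hg,
    (comm_iff_homMatrix hV1 hW1).2 ?_⟩⟩
  -- The matrix of `f` is determined by `f s = t (g × 0)`, since `M` is invertible over `ℚ`.
  refine matrix_eq_of_mul_right_eq hS.source.form ?_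
  rw [comm_iff_matrix.1 S.comm, hM, comm_iff_matrix.1 T.comm, hε,
    (comm_iff_homMatrix hX1 hY1).1 hg]

/-- An isogeny of type `P` and two complements can be given arbitrarily. -/
theorem exists_markedMorphism (h : IsMorphismType δ τ) (I : MarkedIsogeny.{u} δ.D δ.H)
    (hI : homMatrix I.X I.Y I.g = τ.P) (X' : MarkedAV.{u} δ.D') (Y' : MarkedAV.{u} δ.H') :
    ∃ S : MarkedMorphism.{u} δ, S.toIsogeny = I ∧ S.X' = X' ∧ S.Y' = Y' ∧
      sumMatrix S.X S.X' S.V S.e S.e' = τ.M ∧ sumMatrix S.Y S.Y' S.W S.ε S.ε' = τ.N := by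
  obtain ⟨V, e, e', hM⟩ := exists_complementarySum I.X X' h.source
  obtain ⟨W, ε, ε', hN⟩ := exists_complementarySum I.Y Y' h.target
  obtain ⟨G, hG⟩ := h.extension
  obtain ⟨o, ho⟩ := exists_homMatrix_eq_zero X' W
  have hε : τ.N.toCols₁ = homMatrix I.Y W ε := by rw [← hN]; rfl
  obtain ⟨f, hf⟩ := exists_hom_of_sum (e := e) (e' := e') (W := W) (hM ▸ h.source.form) G
    (ε.comp I.g) o (by
      rw [hM, hG, sumMatrix, homMatrix_comp (Y := I.Y), ho, hI, hε])
  refine ⟨⟨I.X, X', V, I.Y, Y', W, f, e, e', ε, ε', I.g,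
    isComplementarySum_iff.2 (hM ▸ h.source), isComplementarySum_iff.2 (hN ▸ h.target),
    I.isogeny, I.pullback, comm_iff_matrix.2 ?_⟩, rfl, rfl, rfl, hM, hN⟩
  rw [hf, hM, hG, hI, hε]

end Types

end AbVar

/-- Let `δ, τ` be a type of morphisms (it satisfies the integral conditions for types of morphisms,
or it is the type of some morphism). The natural map from isomorphism classes of morphisms of type
`δ, τ` relative to symplectic bases is a bijection onto `IS'_{D,H}(P) × A'_{D'} × A'_{H'}`. -/
theorem mainTheorem4 {n n' m' : ℕ} (δ : AbVar.MorPolType n n' m') (τ : AbVar.MorMatrices n n' m')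
    (hτ : AbVar.TypeConditions δ τ ∨ (AbVar.morphismFibre.{u} δ τ).Nonempty) :
    Set.BijOn AbVar.ModuliMorphism.toTriple.{u} (AbVar.morphismFibre.{u} δ τ)
      (AbVar.isogenyFibre.{u} δ.D δ.H τ.P ×ˢ
        (Set.univ : Set (AbVar.ModuliAV.{u} δ.D' × AbVar.ModuliAV.{u} δ.H'))) := by
  have h : AbVar.IsMorphismType δ τ :=
    hτ.elim (fun h => h.isMorphismType) AbVar.isMorphismType_of_nonempty
  refine ⟨fun c hc => ?_, fun c hc c₁ hc₁ hcc => ?_, ?_⟩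
  · induction c using Quotient.inductionOn with
    | h S => exact ⟨congrArg AbVar.MorMatrices.P hc, Set.mem_univ _⟩
  · induction c using Quotient.inductionOn with
    | h S =>
    induction c₁ using Quotient.inductionOn with
    | h T =>
    have hST := hc.trans hc₁.symm
    obtain ⟨aX, aY, hX, hY, hg⟩ := Quotient.exact (congrArg Prod.fst hcc)
    obtain ⟨aX', hX'⟩ := Quotient.exact (congrArg (fun t => t.2.1) hcc)
    obtain ⟨aY', hY'⟩ := Quotient.exact (congrArg (fun t => t.2.2) hcc)
    exact Quotient.sound (AbVar.MarkedMorphism.nonempty_iso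
      (congrArg AbVar.MorMatrices.M hST) (congrArg AbVar.MorMatrices.N hST) hX hY hX' hY' hg)
  · rintro ⟨i, x', y'⟩ ⟨hi, -⟩
    induction i using Quotient.inductionOn with
    | h I =>
    induction x' using Quotient.inductionOn with
    | h X' =>
    induction y' using Quotient.inductionOn with
    | h Y' =>
    obtain ⟨S, rfl, rfl, rfl, hM, hN⟩ := AbVar.exists_markedMorphism h I hi X' Y'
    refine ⟨Quotient.mk _ S, ?_, rfl⟩
    have hP : AbVar.homMatrix S.X S.Y S.g = τ.P := hi
    change AbVar.MorMatrices.mk _ _ _ = τ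
    rw [hM, hN, hP]
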